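/- **Setting.** Let $\Gamma$ be a group with a finite symmetric generating set $S$. In the Cayley graph, $a,b\in\Gamma$ are adjacent if $as=b$ for some $s\in S$. For a finite set $F\subset\Gamma$ let $\partial F$ be the set of points of $F$ adjacent to a point outside $F$, and for $F\neq\emptyset$ let $i(F)=|\partial F|/|F|$. The group $\Gamma$ is *amenable* if there are nonempty finite sets $F_1,F_2,\dots\subset\Gamma$ with $i(F_n)\to0$. A *tiling* of a finite set $F$ by a finite family of nonempty finite sets is a partition of $F$ into left translates $\gamma A$ of members $A$ of the family, each translate being labelled by the member $A$ it comes from. A *Bratteli tiling system* consists of the following data, for all $n\ge1$. - A finite level set $Z_n$ consisting of nonempty finite sets $F^n_1,\dots,F^n_{i_n}\subset\Gamma$ (pairwise distinct) and one further vertex $E_n$, which stands for the one-point set $\{1\}$; each $F^n_j$ satisfies $i(F^n_j)\le 2^{-n}$. - For $n\ge2$, a tiling of each $F^n_j$ by the elements of $Z_{n-1}$. For $A\in Z_{n-1}$, $K(A,F^n_j)$ denotes the number of $A$-translates in it; $E_n$ is tiled by one translate of $E_{n-1}$, so $K(E_{n-1},E_n)=1$ and $K(A,E_n)=0$ for $A\ne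 E_{n-1}$. It is required that $K(E_{n-1},F^n_j)\le 2^{-(n-1)}|F^n_j|$ and that for every $A\in Z_{n-1}$ there is $B\in Z_n$ with $K(A,B)>0$. - A harmonic function $m:\bigsqcup_{n\ge1} Z_n\to[0,1]$, that is, $\sum_{A\in Z_n}m(A)=1$ for every $n\ge1$, and, writing $S(A)=|A|$ for the size of a vertex (so $S(E_n)=1$), $$m(A)=\sum_{B\in Z_{n+1}}\frac{S(A)\,K(A,B)}{S(B)}\,m(B)\qquad(n\ge1,\ A\in Z_n),$$ such that $m(E_n)\to0$ as $n\to\infty$. **Proposition 3.1.** Let $\Gamma$ be an amenable group with a finite symmetric generating set $S$. Then there is a Bratteli tiling system $(\{Z_n\}_{n\ge1},m)$ with the following property. For every $\varepsilon>0$ and $n\ge1$ there is $\delta>0$ such that every nonempty finite set $F\subset\Gamma$ with $i(F)<\delta$ has a tiling by translates of the elements of $Z_n$ for which $$\left|\frac{|T^F_L|}{|F|}-m(L)\right|<\varepsilon\qquad\text{for all } L\in Z_n \text{ (including } L=E_n),$$ where $T^F_L$ is the set of points of $F$ covered by the translates of $L$ in the tiling. -/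

import Mathlib

open Filter Topology
open scoped Pointwise

namespace Bratteli

variable {Γ : Type*} [Group Γ] [DecidableEq Γ]

/-- The boundary of `F` in the Cayley graph of `Γ` with respect to `S`, in which `a` and `b` are
adjacent when `b = a * s` for some `s ∈ S`: the vertices of `F` adjacent to a vertex outside `F`. -/
def boundary (S F : Finset Γ) : Finset Γ :=
  F.filter fun x => ∃ s ∈ S, x * s ∉ F

/-- For symmetric `S` this is the boundary with respect to Mathlib's Cayley graph. -/
theorem mem_boundary_iff {S : Finset Γ} (hS : ∀ s ∈ S, s⁻¹ ∈ S) (F : Finset Γ) (x : Γ) :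
    x ∈ boundary S F ↔
      x ∈ F ∧ ∃ y, y ∉ F ∧ (SimpleGraph.mulCayley (S : Set Γ)).Adj x y := by
  simp only [boundary, Finset.mem_filter, SimpleGraph.mulCayley_adj', Finset.mem_coe]
  refine and_congr_right fun hx => ⟨?_, ?_⟩
  · rintro ⟨s, hs, h⟩
    exact ⟨x * s, h, fun e => h (e ▸ hx), s, hs, Or.inl rfl⟩
  · rintro ⟨y, hy, -, s, hs, rfl | rfl⟩
    · exact ⟨s, hs, hy⟩
    · exact ⟨s⁻¹, hS s hs, by simpa using hy⟩

/-- The isoperimetric constant `|∂F| / |F|` of a (nonempty) finite set. -/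
noncomputable def isoperimetric (S F : Finset Γ) : ℝ :=
  ((boundary S F).card : ℝ) / (F.card : ℝ)

/-- Amenability, in the form used for a group with a finite symmetric generating set `S`: there is
a Følner sequence, i.e. a sequence of nonempty finite sets whose isoperimetric constants in the
Cayley graph tend to `0`. -/
def IsAmenable (S : Finset Γ) : Prop :=
  ∃ F : ℕ → Finset Γ, (∀ n, (F n).Nonempty) ∧
    Tendsto (fun n => isoperimetric S (F n)) atTop (𝓝 0)

/-- `T` is a tiling of `F` by left translates of the sets `A i`: a pair `(γ, i) ∈ T` stands for the
tile `γ • A i`, the tiles are pairwise disjoint, and their union is `F`. -/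
structure IsTiling {ι : Type*} (A : ι → Finset Γ) (T : Finset (Γ × ι)) (F : Finset Γ) : Prop where
  disjoint : (T : Set (Γ × ι)).PairwiseDisjoint fun p => p.1 • A p.2
  union : (T.biUnion fun p => p.1 • A p.2) = F

/-- The set of points covered by the translates of `A L` that occur in `T`. -/
def covered {ι : Type*} [DecidableEq ι] (A : ι → Finset Γ) (T : Finset (Γ × ι)) (L : ι) :
    Finset Γ :=
  (T.filter fun p => p.2 = L).biUnion fun p => p.1 • A p.2

variable (Γ) in
/-- The raw data of a Bratteli system of tiles: at every level `n` a finite collection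
`shapes n` of finite sets, and for every `B ∈ shapes (n + 1)` a list of tiles of level `n` (to be a
partition of `B`). The vertices of level `n` are the elements of `shapes n` together with one
further vertex, encoded as `none`, which stands for the single-point tile `E_n`.
Levels are numbered from `1`; no condition is ever imposed on level `0`. -/
structure TileData where
  shapes : ℕ → Finset (Finset Γ)
  partition : ∀ n, shapes (n + 1) → Finset (Γ × Option (shapes n))

namespace TileData

/-- The vertices of level `n`: the shapes `F^n_j` (as `some`) and `E_n` (as `none`). -/
abbrev Vertex (Z : TileData Γ) (n : ℕ) : Type _ := Option (Z.shapes n)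

/-- The finite set belonging to a vertex; `E_n` is the set `{1}`. -/
def tile (Z : TileData Γ) (n : ℕ) : Z.Vertex n → Finset Γ
  | some A => A.1
  | none => {1}

/-- The size of a vertex: the number of elements of its tile. -/
def size (Z : TileData Γ) (n : ℕ) (A : Z.Vertex n) : ℕ := (Z.tile n A).card

/-- The multiplicity `K(A, B)` of the edge from `A` to `B`: the number of `A`-tiles in the
partition of `B`, where the single point `E_{n+1}` is partitioned into one `E_n`-tile. -/
def mult (Z : TileData Γ) (n : ℕ) (A : Z.Vertex n) : Z.Vertex (n + 1) → ℕ
  | some B => ((Z.partition n B).filter fun p => p.2 = A).card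
  | none => if A = none then 1 else 0

end TileData

/-- `Z` is a Bratteli system of tiles for the Cayley graph of `Γ` with respect to `S`. -/
structure IsBratteliSystem (S : Finset Γ) (Z : TileData Γ) : Prop where
  shape_nonempty : ∀ n, 1 ≤ n → ∀ A ∈ Z.shapes n, A.Nonempty
  isoperimetric_le : ∀ n, 1 ≤ n → ∀ A ∈ Z.shapes n, isoperimetric S A ≤ 1 / 2 ^ n
  isTiling : ∀ n, 1 ≤ n → ∀ B : Z.shapes (n + 1), IsTiling (Z.tile n) (Z.partition n B) B
  /-- The proportion of single points in the partition of a shape of level `n + 1`. -/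
  mult_single_le : ∀ n, 1 ≤ n → ∀ B : Z.shapes (n + 1),
    (Z.mult n none (some B) : ℝ) ≤ 1 / 2 ^ n * (B.1.card : ℝ)
  /-- In a Bratteli diagram every vertex has an outgoing edge. -/
  exists_edge : ∀ n, 1 ≤ n → ∀ A : Z.Vertex n, ∃ B : Z.Vertex (n + 1), 0 < Z.mult n A B

/-- A harmonic function: a probability distribution on each level, with
`m(A) = ∑_B S(A) K(A, B) / S(B) * m(B)`. -/
structure IsHarmonic (Z : TileData Γ) (m : ∀ n, Z.Vertex n → ℝ) : Prop where
  nonneg : ∀ n, 1 ≤ n → ∀ A, 0 ≤ m n A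
  sum_eq_one : ∀ n, 1 ≤ n → ∑ A, m n A = 1
  harmonic : ∀ n, 1 ≤ n → ∀ A : Z.Vertex n,
    m n A = ∑ B : Z.Vertex (n + 1),
      (Z.size n A : ℝ) * (Z.mult n A B : ℝ) / (Z.size (n + 1) B : ℝ) * m (n + 1) B

/-- A Bratteli tiling system: a Bratteli system of tiles with a harmonic function `m` such that
`m(E_n) → 0`. -/
structure IsBratteliTilingSystem (S : Finset Γ) (Z : TileData Γ) (m : ∀ n, Z.Vertex n → ℝ) :
    Prop where
  isBratteliSystem : IsBratteliSystem S Z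
  isHarmonic : IsHarmonic Z m
  tendsto_single : Tendsto (fun n => m n none) atTop (𝓝 0)

/-- The size equation of a Bratteli diagram, `S(B) = ∑_A S(A) K(A, B)`, holds automatically. -/
theorem IsBratteliSystem.size_eq {S : Finset Γ} {Z : TileData Γ} (h : IsBratteliSystem S Z)
    (n : ℕ) (hn : 1 ≤ n) (B : Z.Vertex (n + 1)) :
    Z.size (n + 1) B = ∑ A, Z.size n A * Z.mult n A B := by
  cases B with
  | none =>
    simp [TileData.mult, TileData.size, TileData.tile]
  | some B =>
    have hT := h.isTiling n hn B
    have h1 : Z.size (n + 1) (some B) = ∑ p ∈ Z.partition n B, Z.size n p.2 := by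
      change B.1.card = _
      rw [← hT.union, Finset.card_biUnion hT.disjoint]
      exact Finset.sum_congr rfl fun p _ => Finset.card_smul_finset _ _
    rw [h1, ← Finset.sum_fiberwise (Z.partition n B) (fun p => p.2)]
    refine Finset.sum_congr rfl fun A _ => ?_
    rw [Finset.sum_congr rfl (g := fun _ => Z.size n A)
      (fun p hp => by rw [(Finset.mem_filter.1 hp).2])]
    simp [TileData.mult, mul_comm]

end Bratteli

/-! ### Boundaries and almost invariance in the Cayley graph. -/

namespace Bratteli

variable {Γ : Type*} [Group Γ] [DecidableEq Γ]

/-! The crux is to find finite families of shapes that tile every sufficiently invariant `F` with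
frequencies independent of `F`. The Ornstein–Weiss theorem `exists_isQuasiTiling` nearly covers such
an `F` by disjoint pieces of translates of finitely many very invariant sets `H j`, the `j`-th in
proportion close to a prescribed `w j`. If a family of smaller shapes packs each `H j`, then copying
one fixed packing of `H j` into all its translates packs `F` with frequencies determined, up to a
small error, by `w` and these packings (`exists_frequencies`, `exists_level`).

Families are chosen recursively, each invariant enough to be packed by the one before
(`exists_isShapeSystem`). The frequencies form substochastic matrices whose rows at stage `n` are
all within `(1 / 2) ^ (n + 3)` of one vector `p n` in ℓ¹. Pushing `p (n + k)` down to level `n` is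
therefore Cauchy in `k`, and the limits are harmonic (`IsContracting.exists_tendsto`). A fixed level
only offers a fixed accuracy, but tiling `F` at level `n + k` and refining down does not increase
the ℓ¹ error, so level `n` frequencies come arbitrarily close to the limit
(`exists_realizes_reachable`).

Shapes unreachable from deep levels have limit mass zero and are discarded, which gives every
remaining shape an outgoing edge (`exists_isPrunedSystem`). Uncovered points become singletons, and
`E_n` receives the missing mass, which tends to zero. -/

theorem mem_boundary {S F : Finset Γ} {x : Γ} :
    x ∈ boundary S F ↔ x ∈ F ∧ ∃ s ∈ S, x * s ∉ F := by
  simp [boundary]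

theorem boundary_smul (S F : Finset Γ) (c : Γ) : boundary S (c • F) = c • boundary S F := by
  ext x
  simp only [mem_boundary, ← Finset.inv_smul_mem_iff, smul_eq_mul, mul_assoc]

theorem isoperimetric_smul (S F : Finset Γ) (c : Γ) :
    isoperimetric S (c • F) = isoperimetric S F := by
  simp [isoperimetric, boundary_smul]

theorem isoperimetric_lt_iff {S F : Finset Γ} (hF : F.Nonempty) {δ : ℝ} :
    isoperimetric S F < δ ↔ ((boundary S F).card : ℝ) < δ * F.card :=
  div_lt_iff₀ (by exact_mod_cast hF.card_pos)

theorem isoperimetric_le_iff {S F : Finset Γ} (hF : F.Nonempty) {δ : ℝ} :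
    isoperimetric S F ≤ δ ↔ ((boundary S F).card : ℝ) ≤ δ * F.card :=
  div_le_iff₀ (by exact_mod_cast hF.card_pos)

/-- Right multiplication by `g⁻¹` matches the points of `F` that stay in `F` under `g⁻¹` with those
that stay under `g`. -/
theorem card_exit_inv (F : Finset Γ) (g : Γ) :
    (F.filter fun c => c * g⁻¹ ∉ F).card = (F.filter fun c => c * g ∉ F).card := by
  have h1 : (F.filter fun c => c * g⁻¹ ∈ F).card = (F.filter fun c => c * g ∈ F).card := by
    refine Finset.card_bij (fun c _ => c * g⁻¹) ?_ ?_ ?_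
    · intro c hc
      simp only [Finset.mem_filter] at hc ⊢
      simpa using hc.symm
    · intro a _ b _ h
      simpa using h
    · intro b hb
      simp only [Finset.mem_filter] at hb
      exact ⟨b * g, by simpa using hb.symm, by simp⟩
  have h2 := Finset.card_filter_add_card_filter_not (s := F) (fun c => c * g⁻¹ ∈ F)
  have h3 := Finset.card_filter_add_card_filter_not (s := F) (fun c => c * g ∈ F)
  omega

/-- Write `g` as a word in the generators: a point leaving `F` under `a * b` leaves under `a`, or
its image under `a` is in `F` and leaves under `b`. `K` does not depend on `F`. -/
theorem exists_card_exit_le {S : Finset Γ} (hgen : Subgroup.closure (S : Set Γ) = ⊤) (g : Γ) :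
    ∃ K : ℕ, ∀ F : Finset Γ,
      (F.filter fun c => c * g ∉ F).card ≤ K * (boundary S F).card := by
  have hg : g ∈ Subgroup.closure (S : Set Γ) := hgen ▸ Subgroup.mem_top g
  induction hg using Subgroup.closure_induction with
  | mem s hs =>
    refine ⟨1, fun F => ?_⟩
    rw [one_mul]
    refine Finset.card_le_card fun c hc => ?_
    rw [Finset.mem_filter] at hc
    exact mem_boundary.2 ⟨hc.1, s, hs, hc.2⟩
  | one => exact ⟨0, fun F => by simp⟩
  | mul a b _ _ iha ihb =>
    obtain ⟨K, hK⟩ := iha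
    obtain ⟨L, hL⟩ := ihb
    refine ⟨K + L, fun F => ?_⟩
    have h : (F.filter fun c => c * (a * b) ∉ F) ⊆ (F.filter fun c => c * a ∉ F) ∪
        ((F.filter fun c => c * b ∉ F).image fun c => c * a⁻¹) := by
      intro c hc
      simp only [Finset.mem_filter, Finset.mem_union, Finset.mem_image] at hc ⊢
      by_cases h : c * a ∈ F
      · exact Or.inr ⟨c * a, ⟨h, by rw [mul_assoc]; exact hc.2⟩, by simp⟩
      · exact Or.inl ⟨hc.1, h⟩
    calc _ ≤ _ := Finset.card_le_card h
      _ ≤ _ := Finset.card_union_le _ _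
      _ ≤ _ := add_le_add (hK F) (Finset.card_image_le.trans (hL F))
      _ = _ := by ring
  | inv a _ ih =>
    obtain ⟨K, hK⟩ := ih
    exact ⟨K, fun F => by rw [card_exit_inv]; exact hK F⟩

theorem exists_card_not_smul_subset_le {S : Finset Γ}
    (hgen : Subgroup.closure (S : Set Γ) = ⊤) (H : Finset Γ) :
    ∃ K : ℕ, ∀ F : Finset Γ,
      (F.filter fun c => ¬ c • H ⊆ F).card ≤ K * (boundary S F).card := by
  choose K hK using exists_card_exit_le hgen
  refine ⟨∑ h ∈ H, K h, fun F => ?_⟩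
  have h : (F.filter fun c => ¬ c • H ⊆ F) ⊆ H.biUnion fun h => F.filter fun c => c * h ∉ F := by
    intro c hc
    simp only [Finset.mem_filter, Finset.mem_biUnion, Finset.subset_iff, not_forall,
      Finset.mem_smul_finset] at hc ⊢
    obtain ⟨hc, x, ⟨h, hh, rfl⟩, hx⟩ := hc
    exact ⟨h, hh, hc, hx⟩
  calc _ ≤ _ := Finset.card_le_card h
    _ ≤ _ := Finset.card_biUnion_le
    _ ≤ _ := Finset.sum_le_sum fun h _ => hK h F
    _ = _ := by rw [Finset.sum_mul]

theorem mem_of_boundary_eq_empty {S F : Finset Γ} (hgen : Subgroup.closure (S : Set Γ) = ⊤)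
    (hF : F.Nonempty) (h : boundary S F = ∅) (x : Γ) : x ∈ F := by
  obtain ⟨a, ha⟩ := hF
  obtain ⟨K, hK⟩ := exists_card_exit_le hgen (a⁻¹ * x)
  have h1 := hK F
  rw [h, Finset.card_empty, mul_zero, Nat.le_zero, Finset.card_eq_zero] at h1
  by_contra hx
  have : a ∈ F.filter fun c => c * (a⁻¹ * x) ∉ F := by simp [ha, hx]
  simp [h1] at this

/-- In an infinite group the boundary has at least one point, so a small ratio forces a large
denominator. -/
theorem lt_card_of_isoperimetric_lt [Infinite Γ] {S F : Finset Γ}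
    (hgen : Subgroup.closure (S : Set Γ) = ⊤) (hF : F.Nonempty) {M : ℝ} (hM : 0 < M)
    (h : isoperimetric S F < 1 / M) : M < F.card := by
  have hb : (boundary S F).Nonempty := by
    rw [Finset.nonempty_iff_ne_empty]
    intro h0
    obtain ⟨x, hx⟩ := Infinite.exists_notMem_finset F
    exact hx (mem_of_boundary_eq_empty hgen hF h0 x)
  have h1 : (1 : ℝ) ≤ (boundary S F).card := by exact_mod_cast hb.card_pos
  rw [isoperimetric_lt_iff hF] at h
  have h2 : 1 < 1 / M * (F.card : ℝ) := h1.trans_lt h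
  rwa [one_div_mul_eq_div, one_lt_div hM] at h2

/-! ### Greedy placement of translates of one set. -/

theorem card_inter_smul_eq (H V : Finset Γ) (c : Γ) :
    (c • H ∩ V).card = (H.filter fun h => c * h ∈ V).card := by
  rw [← Finset.card_smul_finset c (H.filter fun h => c * h ∈ V)]
  congr 1
  ext x
  simp only [Finset.mem_inter, Finset.mem_smul_finset, Finset.mem_filter, smul_eq_mul]
  constructor
  · rintro ⟨⟨h, hh, rfl⟩, hV⟩
    exact ⟨h, ⟨hh, hV⟩, rfl⟩
  · rintro ⟨h, ⟨hh, hV⟩, rfl⟩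
    exact ⟨⟨h, hh, rfl⟩, hV⟩

/-- Double counting: for fixed `h ∈ H`, the map `c ↦ c * h` is injective, so at most `V.card`
centres send `h` into `V`. -/
theorem sum_card_smul_inter_le (G H V : Finset Γ) :
    ∑ c ∈ G, (c • H ∩ V).card ≤ H.card * V.card := by
  simp_rw [card_inter_smul_eq, Finset.card_filter]
  rw [Finset.sum_comm, ← smul_eq_mul, ← Finset.sum_const]
  refine Finset.sum_le_sum fun h _ => ?_
  rw [← Finset.card_filter]
  refine Finset.card_le_card_of_injOn (fun c => c * h) ?_ fun a _ b _ hab => by simpa using hab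
  intro c hc
  simpa using (Finset.mem_filter.1 (Finset.mem_coe.1 hc)).2

theorem IsAmenable.exists_isoperimetric_lt {S : Finset Γ} (h : IsAmenable S) {δ : ℝ}
    (hδ : 0 < δ) : ∃ F : Finset Γ, F.Nonempty ∧ isoperimetric S F < δ := by
  obtain ⟨F, hF, hlim⟩ := h
  obtain ⟨n, hn⟩ := (hlim.eventually (gt_mem_nhds hδ)).exists
  exact ⟨F n, hF n, hn⟩

/-- A family of pairwise disjoint pieces, a pair `(c, D)` standing for a piece `D ⊆ c • H`, which
fill up almost all of the translates `c • H` they come from. -/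
structure IsPieceFamily (S H F : Finset Γ) (η : ℝ) (T : Finset (Γ × Finset Γ)) : Prop where
  sub : ∀ p ∈ T, p.2 ⊆ p.1 • H
  inside : ∀ p ∈ T, p.1 • H ⊆ F
  card_sdiff : ∀ p ∈ T, ((p.1 • H \ p.2).card : ℝ) ≤ η * H.card
  card_boundary : ∀ p ∈ T, ((boundary S p.2).card : ℝ) ≤ (boundary S H).card + η * H.card
  disjoint : (T : Set (Γ × Finset Γ)).PairwiseDisjoint Prod.snd
  union : T.biUnion (fun p => p.1 • H) = T.biUnion Prod.snd

theorem card_boundary_sdiff_le {S : Finset Γ} (hsymm : ∀ s ∈ S, s⁻¹ ∈ S) (A V : Finset Γ) :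
    (boundary S (A \ V)).card ≤ (boundary S A).card + (A ∩ (V * insert 1 S)).card := by
  refine (Finset.card_le_card fun x hx => ?_).trans (Finset.card_union_le _ _)
  rw [mem_boundary, Finset.mem_sdiff] at hx
  obtain ⟨⟨hxA, hxV⟩, s, hs, hxs⟩ := hx
  rw [Finset.mem_sdiff, not_and_not_right] at hxs
  rw [Finset.mem_union, mem_boundary, Finset.mem_inter]
  by_cases h : x * s ∈ A
  · refine Or.inr ⟨hxA, Finset.mem_mul.2 ⟨x * s, hxs h, s⁻¹, ?_, by simp⟩⟩
    exact Finset.mem_insert_of_mem (hsymm s hs)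
  · exact Or.inl ⟨hxA, s, hs, h⟩

/-- The new piece is the part of `c • H` not yet covered. Smallness is required on the covered set
thickened by `insert 1 S`: the factor `1` bounds the points lost, and `S` bounds the boundary
created by the cut. -/
theorem IsPieceFamily.insert {S H F : Finset Γ} {η : ℝ} {T : Finset (Γ × Finset Γ)}
    (hsymm : ∀ s ∈ S, s⁻¹ ∈ S) (hT : IsPieceFamily S H F η T) {c : Γ} (hc : c • H ⊆ F)
    (hcV : ((c • H ∩ (T.biUnion Prod.snd * insert 1 S)).card : ℝ) ≤ η * H.card) :
    IsPieceFamily S H F η (insert (c, c • H \ T.biUnion Prod.snd) T) where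
  sub p hp := by
    rcases Finset.mem_insert.1 hp with rfl | hp
    · exact Finset.sdiff_subset
    · exact hT.sub p hp
  inside p hp := by
    rcases Finset.mem_insert.1 hp with rfl | hp
    · exact hc
    · exact hT.inside p hp
  card_sdiff p hp := by
    rcases Finset.mem_insert.1 hp with rfl | hp
    · refine le_trans ?_ hcV
      rw [sdiff_sdiff_right_self, Finset.inf_eq_inter]
      exact_mod_cast Finset.card_le_card (Finset.inter_subset_inter_left fun x hx =>
        Finset.mem_mul.2 ⟨x, hx, 1, Finset.mem_insert_self _ _, mul_one x⟩)
    · exact hT.card_sdiff p hp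
  card_boundary p hp := by
    rcases Finset.mem_insert.1 hp with rfl | hp
    · have h := card_boundary_sdiff_le hsymm (c • H) (T.biUnion Prod.snd)
      rw [boundary_smul, Finset.card_smul_finset] at h
      have h' : ((boundary S (c • H \ T.biUnion Prod.snd)).card : ℝ) ≤ (boundary S H).card +
        (c • H ∩ (T.biUnion Prod.snd * Insert.insert 1 S)).card := by exact_mod_cast h
      linarith
    · exact hT.card_boundary p hp
  disjoint := by
    rw [Finset.coe_insert]
    refine hT.disjoint.insert fun q hq _ => ?_
    exact Finset.sdiff_disjoint.mono_right (Finset.subset_biUnion_of_mem Prod.snd hq)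
  union := by
    rw [Finset.biUnion_insert, Finset.biUnion_insert, hT.union]
    ext x
    simp only [Finset.mem_union, Finset.mem_sdiff]
    tauto

theorem IsPieceFamily.card_union_le {S H F : Finset Γ} {η : ℝ} {T : Finset (Γ × Finset Γ)}
    (hT : IsPieceFamily S H F η T) :
    ((T.biUnion Prod.snd).card : ℝ) ≤ T.card * H.card := by
  rw [← hT.union]
  have := Finset.card_biUnion_le_card_mul T (fun p => p.1 • H) H.card
    fun p _ => (Finset.card_smul_finset _ _).le
  exact_mod_cast this

theorem card_piece_ge {H D : Finset Γ} {η : ℝ} {c : Γ}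
    (h : ((c • H \ D).card : ℝ) ≤ η * H.card) : (1 - η) * H.card ≤ (D.card : ℝ) := by
  have h2 : ((c • H).card : ℝ) ≤ (c • H \ D).card + D.card := by
    exact_mod_cast Finset.card_le_card_sdiff_add_card
  rw [Finset.card_smul_finset] at h2
  linarith

theorem IsPieceFamily.le_card_union {S H F : Finset Γ} {η : ℝ} {T : Finset (Γ × Finset Γ)}
    (hT : IsPieceFamily S H F η T) :
    (1 - η) * (T.card * H.card) ≤ ((T.biUnion Prod.snd).card : ℝ) := by
  rw [Finset.card_biUnion hT.disjoint, Nat.cast_sum]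
  calc _ = ∑ p ∈ T, (1 - η) * (H.card : ℝ) := by rw [Finset.sum_const, nsmul_eq_mul]; ring
    _ ≤ _ := Finset.sum_le_sum fun p hp => card_piece_ge (hT.card_sdiff p hp)

/-- Averaging over the admissible centres, which make up at least half of `F`. In `hβ` the factor
`2` pays for this half and `1 + S.card` for thickening `V`. -/
theorem exists_smul_inter_le {S H F V : Finset Γ} {η β : ℝ} (hF : F.Nonempty)
    (hη : 0 < η) (hβ : 2 * (1 + S.card) * β ≤ η) (hH : H.Nonempty)
    (hG : F.card ≤ 2 * (F.filter fun c => c • H ⊆ F).card) (hV : (V.card : ℝ) < β * F.card) :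
    ∃ c : Γ, c • H ⊆ F ∧ ((c • H ∩ (V * insert 1 S)).card : ℝ) ≤ η * H.card := by
  by_contra! hcon
  set G := F.filter fun c => c • H ⊆ F
  have h1 : (G.card : ℝ) * (η * H.card) ≤ H.card * (V.card * (1 + S.card)) := by
    have h2 : (∑ c ∈ G, ((c • H ∩ (V * insert 1 S)).card : ℝ)) ≤
        H.card * (V * insert 1 S).card := by
      exact_mod_cast sum_card_smul_inter_le G H (V * insert 1 S)
    have h3 : ((V * insert 1 S).card : ℝ) ≤ V.card * (1 + S.card) := by
      have h4 : (insert 1 S).card ≤ 1 + S.card := by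
        rw [add_comm]; exact Finset.card_insert_le _ _
      exact_mod_cast Finset.card_mul_le.trans (Nat.mul_le_mul_left _ h4)
    calc _ = ∑ c ∈ G, η * (H.card : ℝ) := by rw [Finset.sum_const, nsmul_eq_mul]
      _ ≤ _ := Finset.sum_le_sum fun c hc => (hcon c (Finset.mem_filter.1 hc).2).le
      _ ≤ _ := h2
      _ ≤ _ := by gcongr
  have hHpos : (0 : ℝ) < H.card := by exact_mod_cast hH.card_pos
  have hFpos : (0 : ℝ) < F.card := by exact_mod_cast hF.card_pos
  have hG' : (F.card : ℝ) ≤ 2 * G.card := by exact_mod_cast hG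
  have h2 : (G.card : ℝ) * η ≤ V.card * (1 + S.card) := by
    refine le_of_mul_le_mul_right ?_ hHpos
    linarith
  have hS : (0 : ℝ) < 1 + S.card := by positivity
  nlinarith [mul_lt_mul_of_pos_right hV hS, mul_le_mul_of_nonneg_right hβ hFpos.le,
    mul_le_mul_of_nonneg_right hG' hη.le]

theorem exists_isPieceFamily {S H F : Finset Γ} {η β : ℝ} (hsymm : ∀ s ∈ S, s⁻¹ ∈ S)
    (hF : F.Nonempty) (hη : 0 < η) (hη1 : η ≤ 1 / 2) (hβ0 : 0 ≤ β)
    (hβ : 2 * (1 + S.card) * β ≤ η) (hH : H.Nonempty)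
    (hG : F.card ≤ 2 * (F.filter fun c => c • H ⊆ F).card) :
    ∃ T, IsPieceFamily S H F η T ∧ β * F.card ≤ ((T.biUnion Prod.snd).card : ℝ) ∧
      ((T.biUnion Prod.snd).card : ℝ) ≤ β * F.card + H.card := by
  -- Each greedy step covers at least one new point, since `η ≤ 1 / 2` keeps pieces nonempty; taking
  -- `n = F.card + 1` thus rules out the second alternative. Stopping once `β * F.card` is reached
  -- overshoots by at most one translate.
  have key : ∀ n : ℕ, ∃ T, IsPieceFamily S H F η T ∧
      (β * F.card ≤ ((T.biUnion Prod.snd).card : ℝ) ∨ n ≤ (T.biUnion Prod.snd).card) ∧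
      ((T.biUnion Prod.snd).card : ℝ) ≤ β * F.card + H.card := by
    intro n
    induction n with
    | zero =>
      refine ⟨∅, ⟨by simp, by simp, by simp, by simp, by simp, by simp⟩, by simp, ?_⟩
      simp only [Finset.biUnion_empty, Finset.card_empty, Nat.cast_zero]
      positivity
    | succ n ih =>
      obtain ⟨T, hT, h1, h2⟩ := ih
      by_cases h3 : β * F.card ≤ ((T.biUnion Prod.snd).card : ℝ)
      · exact ⟨T, hT, Or.inl h3, h2⟩
      obtain ⟨c, hc, hcV⟩ := exists_smul_inter_le hF hη hβ hH hG (not_le.1 h3)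
      have hT' := hT.insert hsymm hc hcV
      have hHpos : (0 : ℝ) < H.card := by exact_mod_cast hH.card_pos
      have hcard : ((insert (c, c • H \ T.biUnion Prod.snd) T).biUnion Prod.snd).card =
          (c • H \ T.biUnion Prod.snd).card + (T.biUnion Prod.snd).card := by
        rw [Finset.biUnion_insert, Finset.card_union_of_disjoint Finset.sdiff_disjoint]
      refine ⟨_, hT', Or.inr ?_, ?_⟩
      · have h4 := card_piece_ge (hT'.card_sdiff _ (Finset.mem_insert_self _ _))
        have h5 : (0 : ℝ) < ((c • H \ T.biUnion Prod.snd).card : ℝ) :=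
          lt_of_lt_of_le (by nlinarith) h4
        have h6 : 0 < (c • H \ T.biUnion Prod.snd).card := by exact_mod_cast h5
        have := h1.resolve_left h3
        omega
      · rw [hcard, Nat.cast_add]
        have h4 : ((c • H \ T.biUnion Prod.snd).card : ℝ) ≤ H.card := by
          rw [← Finset.card_smul_finset c H]
          exact_mod_cast Finset.card_le_card Finset.sdiff_subset
        linarith [not_le.1 h3]
  obtain ⟨T, hT, h1, h2⟩ := key (F.card + 1)
  refine ⟨T, hT, h1.resolve_right fun h => ?_, h2⟩
  have : (T.biUnion Prod.snd).card ≤ F.card := Finset.card_le_card <|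
    Finset.biUnion_subset.2 fun p hp => (hT.sub p hp).trans (hT.inside p hp)
  omega

/-! ### Quasi-tilings with prescribed weights. -/

/-- A tiling of all but a proportion `ρ` of `F` by pieces of translates of the sets `H j`, where
the proportion of `F` taken up by `H j` is close to `w j`. -/
structure IsQuasiTiling {ι : Type} [Fintype ι] (S : Finset Γ) (H : ι → Finset Γ) (w : ι → ℝ)
    (η ρ : ℝ) (F : Finset Γ) (T : ι → Finset (Γ × Finset Γ)) : Prop where
  sub : ∀ j, ∀ p ∈ T j, p.2 ⊆ p.1 • H j
  card_sdiff : ∀ j, ∀ p ∈ T j, ((p.1 • H j \ p.2).card : ℝ) ≤ η * (H j).card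
  nonempty : ∀ j, ∀ p ∈ T j, p.2.Nonempty
  isoperimetric_le : ∀ j, ∀ p ∈ T j, isoperimetric S p.2 ≤ 4 * η
  subset : ∀ j, ∀ p ∈ T j, p.2 ⊆ F
  disjoint : ∀ i, ∀ p ∈ T i, ∀ j, ∀ q ∈ T j,
    (⟨i, p⟩ : Σ _ : ι, Γ × Finset Γ) ≠ ⟨j, q⟩ → Disjoint p.2 q.2
  leftover : ((F \ Finset.univ.biUnion fun j => (T j).biUnion Prod.snd).card : ℝ) ≤ ρ * F.card
  weight : ∑ j, |((T j).card : ℝ) * (H j).card - w j * F.card| ≤ 3 * η * F.card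

/-- The pieces and the full translates have the same union, so a new boundary point of the remainder
lies next to the boundary of a full translate; the cuts between pieces play no role. -/
theorem card_boundary_sdiff_union_le {S H F : Finset Γ} {η : ℝ} {T : Finset (Γ × Finset Γ)}
    (hsymm : ∀ s ∈ S, s⁻¹ ∈ S) (hT : IsPieceFamily S H F η T) :
    (boundary S (F \ T.biUnion Prod.snd)).card ≤
      (boundary S F).card + T.card * ((boundary S H).card * S.card) := by
  have hsub : boundary S (F \ T.biUnion Prod.snd) ⊆
      boundary S F ∪ T.biUnion fun p => (p.1 • boundary S H) * S := by
    intro x hx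
    rw [mem_boundary, Finset.mem_sdiff, ← hT.union] at hx
    obtain ⟨⟨hxF, hxV⟩, s, hs, hxs⟩ := hx
    rw [Finset.mem_sdiff, not_and_not_right] at hxs
    rw [Finset.mem_union, mem_boundary]
    by_cases h : x * s ∈ F
    · right
      obtain ⟨p, hp, hxp⟩ := Finset.mem_biUnion.1 (hxs h)
      refine Finset.mem_biUnion.2 ⟨p, hp, Finset.mem_mul.2 ⟨x * s, ?_, s⁻¹, hsymm s hs, by simp⟩⟩
      rw [← boundary_smul, mem_boundary]
      refine ⟨hxp, s⁻¹, hsymm s hs, fun h' => hxV ?_⟩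
      exact Finset.mem_biUnion.2 ⟨p, hp, by simpa using h'⟩
    · exact Or.inl ⟨hxF, s, hs, h⟩
  refine (Finset.card_le_card hsub).trans ((Finset.card_union_le _ _).trans ?_)
  refine Nat.add_le_add_left (Finset.card_biUnion_le_card_mul _ _ _ fun p _ => ?_) _
  exact Finset.card_mul_le.trans (by rw [Finset.card_smul_finset])

theorem isoperimetric_piece_le {S H D : Finset Γ} {η : ℝ} {c : Γ} (hη : 0 < η) (hη1 : η ≤ 1 / 2)
    (hH : H.Nonempty) (hHη : isoperimetric S H ≤ η)
    (h : ((c • H \ D).card : ℝ) ≤ η * H.card)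
    (hb : ((boundary S D).card : ℝ) ≤ (boundary S H).card + η * H.card) :
    D.Nonempty ∧ isoperimetric S D ≤ 4 * η := by
  have hHpos : (0 : ℝ) < H.card := by exact_mod_cast hH.card_pos
  have h1 := card_piece_ge h
  have h2 : (0 : ℝ) < D.card := lt_of_lt_of_le (by nlinarith) h1
  have hD : D.Nonempty := Finset.card_pos.1 (by exact_mod_cast h2)
  refine ⟨hD, ?_⟩
  rw [isoperimetric_le_iff hD]
  rw [isoperimetric_le_iff hH] at hHη
  have h3 : η * H.card ≤ η * (2 * D.card) := mul_le_mul_of_nonneg_left (by nlinarith) hη.le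
  linarith

theorem exists_isPieceFamily_of_isoperimetric_lt [Infinite Γ] {S H : Finset Γ} {η β τ : ℝ}
    (hsymm : ∀ s ∈ S, s⁻¹ ∈ S) (hgen : Subgroup.closure (S : Set Γ) = ⊤)
    (hη : 0 < η) (hη1 : η ≤ 1 / 2) (hβ0 : 0 ≤ β)
    (hβ : 2 * (1 + S.card) * β ≤ η) (hτ : 0 < τ) (hH : H.Nonempty) :
    ∃ δ : ℝ, 0 < δ ∧ ∀ F : Finset Γ, F.Nonempty → isoperimetric S F < δ →
      ∃ T, IsPieceFamily S H F η T ∧ β * F.card ≤ ((T.biUnion Prod.snd).card : ℝ) ∧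
      ((T.biUnion Prod.snd).card : ℝ) ≤ (β + τ) * F.card := by
  obtain ⟨K, hK⟩ := exists_card_not_smul_subset_le hgen H
  have hHpos : (0 : ℝ) < H.card := by exact_mod_cast hH.card_pos
  -- The first bound makes `F` so large that `H.card ≤ τ * F.card`, absorbing the overshoot; the
  -- second makes at least half of `F` admissible as centres.
  refine ⟨min (1 / (H.card / τ)) (1 / (2 * (K + 1))), by positivity, fun F hF hi => ?_⟩
  have h1 := lt_card_of_isoperimetric_lt hgen hF (by positivity)
    (hi.trans_le (min_le_left _ _))
  have h2 := hi.trans_le (min_le_right _ _)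
  rw [isoperimetric_lt_iff hF, one_div_mul_eq_div, lt_div_iff₀ (by positivity)] at h2
  rw [div_lt_iff₀ hτ] at h1
  obtain ⟨T, hT, h3, h4⟩ := exists_isPieceFamily (F := F) hsymm hF hη hη1 hβ0 hβ hH (by
    have h5 := Finset.card_filter_add_card_filter_not (s := F) (fun c => c • H ⊆ F)
    have h6 := hK F
    have h7 : (boundary S F).card * (2 * (K + 1)) < F.card := by exact_mod_cast h2
    nlinarith)
  exact ⟨T, hT, h3, by linarith⟩

/-- Here `a` is the total size of the full translates of the new set, `v` the part of `F` they cover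
and `r` the remainder. The inductive error costs `3 * η * (1 - β) * f`, leaving `3 * η * β * f`. The
overlap `a ≤ (1 + 2 * η) * v` uses about two thirds of this, and `τ = η * β / 4` is small enough for
the rest. -/
theorem quasiTiling_error_le {η β τ a v f r e W : ℝ} (hη : 0 < η) (hη1 : η ≤ 1 / 2)
    (hβ0 : 0 ≤ β) (hτ : 4 * τ = η * β) (hf : 0 ≤ f) (hva : v ≤ a) (hav : (1 - η) * a ≤ v)
    (hv1 : β * f ≤ v) (hv2 : v ≤ (β + τ) * f) (hr : r = f - v) (he : e ≤ 3 * η * r)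
    (hW : W ≤ 1) :
    |a - β * f| + (e + W * |r - (1 - β) * f|) ≤ 3 * η * f := by
  have h1 : a ≤ (1 + 2 * η) * v := by
    nlinarith [mul_le_mul_of_nonneg_left hav (by linarith : (0 : ℝ) ≤ 1 + 2 * η),
      mul_nonneg (mul_nonneg hη.le (by linarith : (0 : ℝ) ≤ 1 - 2 * η))
        ((mul_nonneg hβ0 hf).trans (hv1.trans hva))]
  have h2 : |a - β * f| = a - β * f := abs_of_nonneg (by linarith)
  have h3 : |r - (1 - β) * f| ≤ τ * f := by
    rw [abs_le]
    constructor <;> nlinarith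
  have h4 : W * |r - (1 - β) * f| ≤ τ * f := by
    nlinarith [abs_nonneg (r - (1 - β) * f)]
  have h5 : (1 + 2 * η) * v ≤ (1 + 2 * η) * ((β + τ) * f) :=
    mul_le_mul_of_nonneg_left hv2 (by linarith)
  have h6 : 3 * η * r ≤ 3 * η * ((1 - β) * f) := by
    refine mul_le_mul_of_nonneg_left ?_ (by linarith)
    linarith
  have h7 : 0 ≤ τ * f := mul_nonneg (by nlinarith) hf
  have h8 : 4 * (τ * f) = η * (β * f) := by rw [← mul_assoc, hτ, mul_assoc]
  rw [h2]
  nlinarith [mul_nonneg hη.le h7]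

theorem IsQuasiTiling.option {ι : Type} [Fintype ι] {S : Finset Γ} {H : ι → Finset Γ}
    {w : ι → ℝ} {η β τ ρ : ℝ} {F H₀ : Finset Γ} {T : ι → Finset (Γ × Finset Γ)}
    {T₀ : Finset (Γ × Finset Γ)} (hη : 0 < η) (hη1 : η ≤ 1 / 2) (hβ0 : 0 ≤ β)
    (hτ : 4 * τ = η * β) (hρ : 0 ≤ ρ) (hw0 : ∀ j, 0 ≤ w j) (hw1 : ∑ j, w j ≤ 1)
    (hH₀ : H₀.Nonempty) (hi : isoperimetric S H₀ ≤ η)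
    (hT₀ : IsPieceFamily S H₀ F η T₀) (h1 : β * F.card ≤ ((T₀.biUnion Prod.snd).card : ℝ))
    (h2 : ((T₀.biUnion Prod.snd).card : ℝ) ≤ (β + τ) * F.card)
    (hT : IsQuasiTiling S H w η ρ (F \ T₀.biUnion Prod.snd) T) :
    IsQuasiTiling S (fun j : Option ι => j.elim H₀ H)
      (fun j : Option ι => j.elim β fun j => (1 - β) * w j) η ((1 - β) * ρ) F
      (fun j : Option ι => j.elim T₀ T) := by
  have hsubF : T₀.biUnion Prod.snd ⊆ F :=
    Finset.biUnion_subset.2 fun p hp => (hT₀.sub p hp).trans (hT₀.inside p hp)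
  have hcard : ((F \ T₀.biUnion Prod.snd).card : ℝ) = F.card - (T₀.biUnion Prod.snd).card := by
    rw [Finset.cast_card_sdiff hsubF]
  have hdisj : ∀ p ∈ T₀, ∀ j, ∀ q ∈ T j, Disjoint p.2 q.2 := fun p hp j q hq =>
    Finset.disjoint_sdiff.mono (Finset.subset_biUnion_of_mem Prod.snd hp) (hT.subset j q hq)
  refine ⟨?_, ?_, ?_, ?_, ?_, ?_, ?_, ?_⟩
  · rintro (_ | j)
    exacts [hT₀.sub, hT.sub j]
  · rintro (_ | j)
    exacts [hT₀.card_sdiff, hT.card_sdiff j]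
  · rintro (_ | j)
    exacts [fun p hp => (isoperimetric_piece_le hη hη1 hH₀ hi (hT₀.card_sdiff p hp)
      (hT₀.card_boundary p hp)).1, hT.nonempty j]
  · rintro (_ | j)
    exacts [fun p hp => (isoperimetric_piece_le hη hη1 hH₀ hi (hT₀.card_sdiff p hp)
      (hT₀.card_boundary p hp)).2, hT.isoperimetric_le j]
  · rintro (_ | j)
    exacts [fun p hp => (hT₀.sub p hp).trans (hT₀.inside p hp),
      fun p hp => (hT.subset j p hp).trans Finset.sdiff_subset]
  · rintro (_ | i) p hp (_ | j) q hq hne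
    · exact hT₀.disjoint hp hq fun h => hne (by rw [h])
    · exact hdisj p hp j q hq
    · exact (hdisj q hq i p hp).symm
    · refine hT.disjoint i p hp j q hq fun h => hne ?_
      cases h
      rfl
  · have hset : (F \ Finset.univ.biUnion fun j : Option ι =>
        (j.elim T₀ T : Finset (Γ × Finset Γ)).biUnion Prod.snd) =
        (F \ T₀.biUnion Prod.snd) \ Finset.univ.biUnion fun j => (T j).biUnion Prod.snd := by
      ext x
      simp only [Finset.mem_sdiff, Finset.mem_biUnion, Finset.mem_univ, true_and, Option.exists,
        Option.elim]
      rw [not_or, and_assoc]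
    rw [hset]
    refine hT.leftover.trans ?_
    nlinarith
  · rw [Fintype.sum_option]
    simp only [Option.elim]
    have hbound : ∑ j, |((T j).card : ℝ) * (H j).card - (1 - β) * w j * F.card| ≤
        ∑ j, |((T j).card : ℝ) * (H j).card - w j * (F \ T₀.biUnion Prod.snd).card| +
        (∑ j, w j) * |((F \ T₀.biUnion Prod.snd).card : ℝ) - (1 - β) * F.card| := by
      rw [Finset.sum_mul, ← Finset.sum_add_distrib]
      refine Finset.sum_le_sum fun j _ => ?_
      rw [← abs_of_nonneg (hw0 j), ← abs_mul, abs_of_nonneg (hw0 j)]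
      refine le_of_eq_of_le ?_ (abs_add_le _ _)
      congr 1
      ring
    refine (add_le_add_right hbound _).trans ?_
    exact quasiTiling_error_le hη hη1 hβ0 hτ (Nat.cast_nonneg _) hT₀.card_union_le
      hT₀.le_card_union h1 h2 hcard hT.weight hw1

/-- Each round covers a proportion close to `β` of what is left. The set added in the induction is
placed first, and must be so invariant that the remainder still satisfies the induction hypothesis.
-/
theorem exists_isQuasiTiling_pow [Infinite Γ] {S : Finset Γ} {η β α : ℝ}
    (hsymm : ∀ s ∈ S, s⁻¹ ∈ S) (hgen : Subgroup.closure (S : Set Γ) = ⊤) (hamen : IsAmenable S)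
    (hη : 0 < η) (hη1 : η ≤ 1 / 2) (hβ0 : 0 < β)
    (hβ : 2 * (1 + S.card) * β ≤ η) (hα : 0 < α) (k : ℕ) :
    ∃ (ι : Type) (_ : Fintype ι) (H : ι → Finset Γ) (w : ι → ℝ) (δ : ℝ), 0 < δ ∧
      (∀ j, (H j).Nonempty ∧ isoperimetric S (H j) < α) ∧ (∀ j, 0 ≤ w j) ∧
      ∑ j, w j = 1 - (1 - β) ^ k ∧
      ∀ F : Finset Γ, F.Nonempty → isoperimetric S F < δ →
        ∃ T, IsQuasiTiling S H w η ((1 - β) ^ k) F T := by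
  have hβ1 : β ≤ 1 / 4 := by
    nlinarith [mul_nonneg (Nat.cast_nonneg (α := ℝ) S.card) hβ0.le]
  have hpow : ∀ k, 0 ≤ (1 - β) ^ k := fun k => pow_nonneg (by linarith) k
  induction k with
  | zero =>
    refine ⟨Empty, inferInstance, fun j => j.elim, fun j => j.elim, 1, one_pos, fun j => j.elim,
      fun j => j.elim, by simp, fun F _ _ => ⟨fun j => j.elim, fun j => j.elim, fun j => j.elim,
      fun j => j.elim, fun j => j.elim, fun j => j.elim, fun j => j.elim, by simp, ?_⟩⟩
    simp only [Finset.univ_eq_empty, Finset.sum_empty]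
    positivity
  | succ k ih =>
    obtain ⟨ι, _, H, w, δ, hδ, hH, hw0, hw1, hF⟩ := ih
    -- The bound `η` makes the pieces almost invariant. The bound `δ / (8 * (S.card + 1))` lets the
    -- translates add at most `δ / 8 * F.card` to the boundary; with `δ / 4` from `F` this stays
    -- below `δ` times the remainder, which is at least half of `F`.
    obtain ⟨H₀, hH₀, hi⟩ := hamen.exists_isoperimetric_lt
      (show 0 < min α (min η (δ / (8 * (S.card + 1)))) by positivity)
    obtain ⟨δ', hδ', hP⟩ := exists_isPieceFamily_of_isoperimetric_lt hsymm hgen hη hη1 hβ0.le hβ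
      (show 0 < η * β / 4 by positivity) hH₀
    refine ⟨Option ι, inferInstance, fun j => j.elim H₀ H,
      fun j => j.elim β fun j => (1 - β) * w j, min δ' (δ / 4), by positivity, ?_, ?_, ?_, ?_⟩
    · rintro (_ | j)
      exacts [⟨hH₀, hi.trans_le (min_le_left _ _)⟩, hH j]
    · rintro (_ | j)
      exacts [hβ0.le, mul_nonneg (by linarith) (hw0 j)]
    · rw [Fintype.sum_option]
      simp only [Option.elim]
      rw [← Finset.mul_sum, hw1]
      ring
    · intro F hFne hFi
      obtain ⟨T₀, hT₀, h1, h2⟩ := hP F hFne (hFi.trans_le (min_le_left _ _))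
      have hsubF : T₀.biUnion Prod.snd ⊆ F :=
        Finset.biUnion_subset.2 fun p hp => (hT₀.sub p hp).trans (hT₀.inside p hp)
      have hfpos : (0 : ℝ) < F.card := by exact_mod_cast hFne.card_pos
      have hcard : ((F \ T₀.biUnion Prod.snd).card : ℝ) =
          F.card - (T₀.biUnion Prod.snd).card := by
        rw [Finset.cast_card_sdiff hsubF]
      have hhalf : (F.card : ℝ) / 2 ≤ (F \ T₀.biUnion Prod.snd).card := by
        rw [hcard]
        nlinarith [mul_le_mul hη1 hβ1 hβ0.le (by norm_num)]
      have hRne : (F \ T₀.biUnion Prod.snd).Nonempty := by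
        refine Finset.card_pos.1 ?_
        have : (0 : ℝ) < (F \ T₀.biUnion Prod.snd).card := by linarith
        exact_mod_cast this
      obtain ⟨T, hT⟩ := hF (F \ T₀.biUnion Prod.snd) hRne (by
        rw [isoperimetric_lt_iff hRne]
        have hb1 := hFi.trans_le (min_le_right _ _)
        rw [isoperimetric_lt_iff hFne] at hb1
        have hb2 := (hi.trans_le ((min_le_right _ _).trans (min_le_right _ _)))
        rw [isoperimetric_lt_iff hH₀] at hb2
        have hb3 : ((boundary S (F \ T₀.biUnion Prod.snd)).card : ℝ) ≤
            (boundary S F).card + T₀.card * ((boundary S H₀).card * S.card) := by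
          exact_mod_cast card_boundary_sdiff_union_le hsymm hT₀
        have hb4 : (T₀.card : ℝ) * H₀.card ≤ F.card := by
          have := hT₀.le_card_union
          have h0 : (0 : ℝ) ≤ (T₀.card : ℝ) * H₀.card := by positivity
          nlinarith
        have hb5 : (T₀.card : ℝ) * ((boundary S H₀).card * S.card) ≤ δ / 8 * F.card := by
          calc (T₀.card : ℝ) * ((boundary S H₀).card * S.card)
              ≤ T₀.card * ((δ / (8 * (S.card + 1)) * H₀.card) * (S.card + 1)) := by
                gcongr
                linarith
            _ = δ / 8 * (T₀.card * H₀.card) := by field_simp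
            _ ≤ _ := by gcongr
        nlinarith)
      exact ⟨_, by
        rw [pow_succ']
        exact hT.option hη hη1 hβ0.le (by ring) (hpow k) hw0 (by linarith [hpow k]) hH₀
          (hi.le.trans ((min_le_right _ _).trans (min_le_left _ _))) hT₀ h1 h2⟩

/-- The quasi-tiling theorem of Ornstein and Weiss, with control of the weights. -/
theorem exists_isQuasiTiling {S : Finset Γ} {η α : ℝ}
    (hsymm : ∀ s ∈ S, s⁻¹ ∈ S) (hgen : Subgroup.closure (S : Set Γ) = ⊤) (hamen : IsAmenable S)
    (hη : 0 < η) (hη1 : η ≤ 1 / 2) (hα : 0 < α) :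
    ∃ (ι : Type) (_ : Fintype ι) (H : ι → Finset Γ) (w : ι → ℝ) (δ : ℝ), 0 < δ ∧
      (∀ j, (H j).Nonempty ∧ isoperimetric S (H j) < α) ∧ (∀ j, 0 ≤ w j) ∧
      1 - η ≤ ∑ j, w j ∧ ∑ j, w j ≤ 1 ∧
      ∀ F : Finset Γ, F.Nonempty → isoperimetric S F < δ →
        ∃ T, IsQuasiTiling S H w η η F T := by
  -- The greedy argument needs arbitrarily large sets. In a finite group, a ratio below `1 /
  -- Fintype.card Γ` forces an empty boundary, so `F` is the whole group and serves as its own tile.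
  rcases finite_or_infinite Γ with hfin | hinf
  · have := Fintype.ofFinite Γ
    have hbd : boundary S (Finset.univ : Finset Γ) = ∅ := by ext x; simp [mem_boundary]
    have huniv : isoperimetric S (Finset.univ : Finset Γ) = 0 := by simp [isoperimetric, hbd]
    have hpos : (0 : ℝ) < Fintype.card Γ := by exact_mod_cast Fintype.card_pos
    refine ⟨Unit, inferInstance, fun _ => Finset.univ, fun _ => 1, 1 / Fintype.card Γ,
      by positivity, fun _ => ⟨Finset.univ_nonempty, by rwa [huniv]⟩, by simp, by simp [hη.le],
      by simp, fun F hF hFi => ?_⟩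
    have hF1 : F = Finset.univ := by
      refine Finset.eq_univ_of_forall (mem_of_boundary_eq_empty hgen hF ?_)
      rw [isoperimetric_lt_iff hF, one_div_mul_eq_div, lt_div_iff₀ hpos] at hFi
      have h1 : (boundary S F).card * Fintype.card Γ < F.card := by exact_mod_cast hFi
      have h2 := F.card_le_univ
      rw [← Finset.card_eq_zero]
      by_contra h3
      nlinarith [Nat.one_le_iff_ne_zero.2 h3]
    subst hF1
    refine ⟨fun _ => {(1, Finset.univ)}, ⟨by simp, ?_, by simp, ?_, by simp, by simp, ?_, ?_⟩⟩
    · simp only [Finset.mem_singleton, forall_eq, one_smul, sdiff_self, Finset.bot_eq_empty,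
        Finset.card_empty, Nat.cast_zero]
      intro _
      positivity
    · simp only [Finset.mem_singleton, forall_eq, huniv]
      intro _
      positivity
    · simp
      positivity
    · simp
      positivity
  · have hS : (0 : ℝ) < 2 * (1 + S.card) := by positivity
    have hβ0 : 0 < η / (2 * (1 + S.card)) := by positivity
    have hβ1 : η / (2 * (1 + S.card)) ≤ 1 := by
      rw [div_le_one hS]
      have : (0 : ℝ) ≤ S.card := Nat.cast_nonneg _
      linarith
    obtain ⟨k, hk⟩ := exists_pow_lt_of_lt_one hη
      (show 1 - η / (2 * (1 + S.card)) < 1 by linarith)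
    obtain ⟨ι, hι, H, w, δ, hδ, hH, hw0, hw1, hF⟩ := exists_isQuasiTiling_pow hsymm hgen hamen hη
      hη1 hβ0 (by rw [mul_div_cancel₀ _ hS.ne']) hα k
    refine ⟨ι, hι, H, w, δ, hδ, hH, hw0, by linarith, ?_, fun F h1 h2 => ?_⟩
    · have : 0 ≤ (1 - η / (2 * (1 + S.card))) ^ k := pow_nonneg (by linarith) k
      linarith
    · obtain ⟨T, hT⟩ := hF F h1 h2
      exact ⟨T, hT.sub, hT.card_sdiff, hT.nonempty, hT.isoperimetric_le, hT.subset, hT.disjoint,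
        hT.leftover.trans (by gcongr), hT.weight⟩

/-! ### Packings and their multiplicities. -/

/-- A finite family of pairwise disjoint translates, contained in `F`, of nonempty finite sets. -/
structure IsPacking (T : Finset (Γ × Finset Γ)) (F : Finset Γ) : Prop where
  nonempty : ∀ p ∈ T, p.2.Nonempty
  subset : ∀ p ∈ T, p.1 • p.2 ⊆ F
  disjoint : (T : Set (Γ × Finset Γ)).PairwiseDisjoint fun p => p.1 • p.2

/-- `F` has a packing in which the set `A` is used `N A` times. -/
def Realizes (F : Finset Γ) (N : Finset Γ → ℕ) : Prop :=
  ∃ T, IsPacking T F ∧ ∀ A, (T.filter fun p => p.2 = A).card = N A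

theorem IsPacking.sum_card_le {T : Finset (Γ × Finset Γ)} {F : Finset Γ} (h : IsPacking T F) :
    ∑ p ∈ T, p.2.card ≤ F.card := by
  calc _ = ∑ p ∈ T, (p.1 • p.2).card :=
        Finset.sum_congr rfl fun p _ => (Finset.card_smul_finset _ _).symm
    _ = (T.biUnion fun p => p.1 • p.2).card := (Finset.card_biUnion h.disjoint).symm
    _ ≤ _ := Finset.card_le_card (Finset.biUnion_subset.2 h.subset)

theorem Realizes.sum_le {F : Finset Γ} {N : Finset Γ → ℕ} (h : Realizes F N)
    (Y : Finset (Finset Γ)) : ∑ A ∈ Y, N A * A.card ≤ F.card := by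
  obtain ⟨T, hT, hN⟩ := h
  refine le_trans ?_ hT.sum_card_le
  calc ∑ A ∈ Y, N A * A.card = ∑ A ∈ Y, ∑ p ∈ T.filter (fun p => p.2 = A), p.2.card := by
        refine Finset.sum_congr rfl fun A _ => ?_
        rw [Finset.sum_congr rfl (g := fun _ => A.card)
          fun p hp => by rw [(Finset.mem_filter.1 hp).2], Finset.sum_const, hN, smul_eq_mul]
    _ ≤ _ := by
      rw [Finset.sum_fiberwise_eq_sum_filter]
      exact Finset.sum_le_sum_of_subset (Finset.filter_subset _ _)

theorem IsPacking.card_le {T : Finset (Γ × Finset Γ)} {F : Finset Γ} (h : IsPacking T F) :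
    T.card ≤ F.card := by
  refine le_trans ?_ h.sum_card_le
  rw [Finset.card_eq_sum_ones]
  exact Finset.sum_le_sum fun p hp => (h.nonempty p hp).card_pos

theorem Realizes.le_card {F : Finset Γ} {N : Finset Γ → ℕ} (h : Realizes F N)
    (A : Finset Γ) : N A ≤ F.card := by
  obtain ⟨T, hT, hN⟩ := h
  rw [← hN]
  exact (Finset.card_le_card (Finset.filter_subset _ _)).trans hT.card_le

theorem Realizes.smul {F : Finset Γ} {N : Finset Γ → ℕ} (h : Realizes F N) (c : Γ) :
    Realizes (c • F) N := by
  obtain ⟨T, hT, hN⟩ := h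
  have hinj : Function.Injective fun p : Γ × Finset Γ => (c * p.1, p.2) := by
    rintro ⟨a, A⟩ ⟨b, B⟩ h
    simpa using h
  refine ⟨T.image fun p => (c * p.1, p.2), ⟨?_, ?_, ?_⟩, fun A => ?_⟩
  · simp only [Finset.mem_image, forall_exists_index, and_imp, forall_apply_eq_imp_iff₂]
    exact hT.nonempty
  · simp only [Finset.mem_image, forall_exists_index, and_imp, forall_apply_eq_imp_iff₂]
    intro p hp
    rw [mul_smul]
    exact Finset.smul_finset_subset_smul_finset (hT.subset p hp)
  · intro q hq q' hq' hne
    obtain ⟨p, hp, rfl⟩ := Finset.mem_image.1 (Finset.mem_coe.1 hq)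
    obtain ⟨p', hp', rfl⟩ := Finset.mem_image.1 (Finset.mem_coe.1 hq')
    have := hT.disjoint hp hp' fun h => hne (by rw [h])
    simp only [Function.onFun, mul_smul] at this ⊢
    rw [Finset.disjoint_left] at this ⊢
    intro x hx hx'
    obtain ⟨y, hy, rfl⟩ := Finset.mem_smul_finset.1 hx
    exact this hy (by simpa using hx')
  · rw [← hN A, Finset.filter_image, Finset.card_image_of_injective _ hinj]

theorem realizes_single {A : Finset Γ} (hA : A.Nonempty) (c : Γ) :
    Realizes (c • A) (Pi.single A 1) := by
  refine ⟨{(c, A)}, ⟨by simpa using hA, by simp, by simp⟩, fun B => ?_⟩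
  rw [Finset.filter_singleton, Pi.single_apply]
  by_cases h : B = A
  · simp [h]
  · simp [h, Ne.symm h]

/-- Keep only the tiles inside `D`. Each discarded tile contains a point of `F \ D`, and these
points differ because the tiles are disjoint. -/
theorem Realizes.restrict {F D : Finset Γ} {N : Finset Γ → ℕ} (h : Realizes F N) :
    ∃ N', Realizes D N' ∧ ∀ A, N' A ≤ N A ∧ N A ≤ N' A + (F \ D).card := by
  obtain ⟨T, hT, hN⟩ := h
  refine ⟨fun A => ((T.filter fun p => p.1 • p.2 ⊆ D).filter fun p => p.2 = A).card,
    ⟨T.filter fun p => p.1 • p.2 ⊆ D, ⟨?_, ?_, ?_⟩, fun A => rfl⟩, fun A => ⟨?_, ?_⟩⟩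
  · exact fun p hp => hT.nonempty p (Finset.mem_filter.1 hp).1
  · exact fun p hp => (Finset.mem_filter.1 hp).2
  · exact hT.disjoint.subset (by exact_mod_cast Finset.filter_subset _ _)
  · rw [← hN A]
    exact Finset.card_le_card (Finset.filter_subset_filter _ (Finset.filter_subset _ _))
  · have h1 : (T.filter fun p => ¬ p.1 • p.2 ⊆ D).card ≤ (F \ D).card := by
      have hne : ∀ p : Γ × Finset Γ, p ∈ T.filter (fun p => ¬ p.1 • p.2 ⊆ D) →
          ∃ x ∈ p.1 • p.2, x ∉ D := fun p hp => by
        simpa [Finset.subset_iff] using (Finset.mem_filter.1 hp).2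
      choose! f hf hfD using hne
      refine Finset.card_le_card_of_injOn f ?_ ?_
      · intro p hp
        have hp' := Finset.mem_coe.1 hp
        exact Finset.mem_coe.2 (Finset.mem_sdiff.2
          ⟨hT.subset p (Finset.mem_filter.1 hp').1 (hf p hp'), hfD p hp'⟩)
      · intro p hp q hq hpq
        have hp' := Finset.mem_coe.1 hp
        have hq' := Finset.mem_coe.1 hq
        by_contra hne
        refine Finset.disjoint_left.1 (hT.disjoint (Finset.mem_coe.2 (Finset.mem_filter.1 hp').1)
          (Finset.mem_coe.2 (Finset.mem_filter.1 hq').1) hne) (hf p hp') ?_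
        rw [hpq]
        exact hf q hq'
    rw [← hN A]
    refine le_trans ?_ (Nat.add_le_add_left h1 _)
    refine le_trans (Finset.card_le_card ?_) (Finset.card_union_le _ _)
    intro p hp
    simp only [Finset.mem_union, Finset.mem_filter] at hp ⊢
    tauto

theorem realizes_sum {κ : Type*} {J : Finset κ} {D : κ → Finset Γ} {F : Finset Γ}
    {N : κ → Finset Γ → ℕ} (hsub : ∀ j ∈ J, D j ⊆ F)
    (hdisj : (J : Set κ).PairwiseDisjoint D) (h : ∀ j ∈ J, Realizes (D j) (N j)) :
    Realizes F fun A => ∑ j ∈ J, N j A := by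
  choose! T hT hN using h
  have hd : ∀ i ∈ J, ∀ j ∈ J, i ≠ j → ∀ p ∈ T i, ∀ q ∈ T j, Disjoint (p.1 • p.2) (q.1 • q.2) :=
    fun i hi j hj hij p hp q hq => (hdisj hi hj hij).mono ((hT i hi).subset p hp)
      ((hT j hj).subset q hq)
  refine ⟨J.biUnion T, ⟨?_, ?_, ?_⟩, fun A => ?_⟩
  · intro p hp
    obtain ⟨j, hj, hp⟩ := Finset.mem_biUnion.1 hp
    exact (hT j hj).nonempty p hp
  · intro p hp
    obtain ⟨j, hj, hp⟩ := Finset.mem_biUnion.1 hp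
    exact ((hT j hj).subset p hp).trans (hsub j hj)
  · intro p hp q hq hne
    obtain ⟨i, hi, hp⟩ := Finset.mem_biUnion.1 (Finset.mem_coe.1 hp)
    obtain ⟨j, hj, hq⟩ := Finset.mem_biUnion.1 (Finset.mem_coe.1 hq)
    by_cases hij : i = j
    · subst hij
      exact (hT i hi).disjoint hp hq hne
    · exact hd i hi j hj hij p hp q hq
  · rw [Finset.filter_biUnion, Finset.card_biUnion]
    · exact Finset.sum_congr rfl fun j hj => hN j hj A
    · intro i hi j hj hij
      rw [Function.onFun, Finset.disjoint_left]
      intro p hp hp'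
      have hp := (Finset.mem_filter.1 hp).1
      have := hd i hi j hj hij p hp p (Finset.mem_filter.1 hp').1
      rw [disjoint_self, Finset.bot_eq_empty, Finset.smul_finset_eq_empty] at this
      exact ((hT i hi).nonempty p hp).ne_empty this

theorem IsQuasiTiling.pairwiseDisjoint {ι : Type} [Fintype ι] {S F : Finset Γ}
    {H : ι → Finset Γ} {w : ι → ℝ} {η ρ : ℝ} {T : ι → Finset (Γ × Finset Γ)}
    (hT : IsQuasiTiling S H w η ρ F T) :
    ((Finset.univ.sigma T : Finset (Σ _ : ι, Γ × Finset Γ)) :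
      Set (Σ _ : ι, Γ × Finset Γ)).PairwiseDisjoint fun q => q.2.2 := by
  rintro ⟨i, p⟩ hp ⟨j, q⟩ hq hne
  simp only [Finset.coe_sigma, Set.mem_sigma_iff, Finset.mem_coe] at hp hq
  exact hT.disjoint i p hp.2 j q hq.2 hne

/-! ### Shapes whose frequencies do not depend on the set being packed. -/

theorem exists_shapes {S : Finset Γ} (hsymm : ∀ s ∈ S, s⁻¹ ∈ S)
    (hgen : Subgroup.closure (S : Set Γ) = ⊤) (hamen : IsAmenable S) {η : ℝ} (hη : 0 < η) :
    ∃ (Y : Finset (Finset Γ)) (δ : ℝ), 0 < δ ∧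
      (∀ A ∈ Y, A.Nonempty ∧ isoperimetric S A < η) ∧
      ∀ F : Finset Γ, F.Nonempty → isoperimetric S F < δ →
        ∃ N, Realizes F N ∧ (∀ A, A ∉ Y → N A = 0) ∧
          (1 - η) * F.card ≤ ∑ A ∈ Y, (N A : ℝ) * A.card := by
  -- Pieces have ratio at most four times this parameter, hence below `η`. Translated back, they are
  -- subsets of the finitely many `H j`, so finitely many shapes suffice for all `F`.
  obtain ⟨ι, _, H, w, δ, hδ, -, -, -, -, hF⟩ := exists_isQuasiTiling (η := min (η / 5) (1 / 2))
    hsymm hgen hamen (by positivity) (min_le_right _ _) one_pos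
  refine ⟨(Finset.univ.biUnion fun j => (H j).powerset).filter
    fun A => A.Nonempty ∧ isoperimetric S A < η, δ, hδ,
    fun A hA => (Finset.mem_filter.1 hA).2, fun F hFne hFi => ?_⟩
  set Y := (Finset.univ.biUnion fun j => (H j).powerset).filter
    fun A => A.Nonempty ∧ isoperimetric S A < η with hY
  obtain ⟨T, hT⟩ := hF F hFne hFi
  set J : Finset (Σ _ : ι, Γ × Finset Γ) := Finset.univ.sigma T with hJ
  have hshape : ∀ q ∈ J, q.2.1⁻¹ • q.2.2 ∈ Y := by
    rintro ⟨j, p⟩ hp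
    have hp : p ∈ T j := (Finset.mem_sigma.1 hp).2
    refine Finset.mem_filter.2 ⟨Finset.mem_biUnion.2 ⟨j, Finset.mem_univ _, ?_⟩, ?_, ?_⟩
    · rw [Finset.mem_powerset, Finset.smul_finset_subset_iff, inv_inv]
      exact hT.sub j p hp
    · exact (hT.nonempty j p hp).smul_finset
    · rw [isoperimetric_smul]
      refine (hT.isoperimetric_le j p hp).trans_lt ?_
      have := min_le_left (η / 5) (1 / 2)
      linarith
  refine ⟨_, realizes_sum (J := J) (D := fun q => q.2.2)
    (N := fun q => Pi.single (q.2.1⁻¹ • q.2.2) 1) ?_ hT.pairwiseDisjoint ?_, ?_, ?_⟩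
  · rintro ⟨j, p⟩ hp
    exact hT.subset j p (Finset.mem_sigma.1 hp).2
  · rintro ⟨j, p⟩ hp
    have := realizes_single (A := p.1⁻¹ • p.2)
      ((hT.nonempty j p (Finset.mem_sigma.1 hp).2).smul_finset) p.1
    rwa [smul_inv_smul] at this
  · intro A hA
    refine Finset.sum_eq_zero fun q hq => ?_
    rw [Pi.single_apply, if_neg]
    rintro rfl
    exact hA (hshape q hq)
  · have h1 : ∑ A ∈ Y, (((∑ q ∈ J, (Pi.single (q.2.1⁻¹ • q.2.2) 1 : Finset Γ → ℕ) A : ℕ)) : ℝ) *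
        A.card = (Finset.univ.biUnion fun j => (T j).biUnion Prod.snd).card := by
      have h2 : (Finset.univ.biUnion fun j => (T j).biUnion Prod.snd) =
          J.biUnion fun q => q.2.2 := by
        ext x
        simp [hJ, Finset.mem_sigma]
      rw [h2, Finset.card_biUnion hT.pairwiseDisjoint, Nat.cast_sum]
      simp_rw [Nat.cast_sum, Finset.sum_mul]
      rw [Finset.sum_comm]
      refine Finset.sum_congr rfl fun q hq => ?_
      rw [Finset.sum_eq_single (q.2.1⁻¹ • q.2.2)]
      · simp
      · intro A _ hA
        rw [Pi.single_apply, if_neg hA, Nat.cast_zero, zero_mul]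
      · exact fun h => absurd (hshape q hq) h
    rw [h1]
    have h3 := hT.leftover
    rw [Finset.cast_card_sdiff (Finset.biUnion_subset.2 fun j _ => Finset.biUnion_subset.2
      fun p hp => hT.subset j p hp)] at h3
    have h4 : min (η / 5) (1 / 2) * (F.card : ℝ) ≤ η * F.card := by
      refine mul_le_mul_of_nonneg_right ?_ (Nat.cast_nonneg _)
      exact (min_le_left _ _).trans (by linarith)
    linarith

theorem exists_pos_le_and_mul_le {M ε : ℝ} (hM : 0 ≤ M) (hε : 0 < ε) :
    ∃ η : ℝ, 0 < η ∧ η ≤ 1 / 2 ∧ η ≤ ε ∧ 6 * η * M ≤ ε := by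
  have hpos : 0 < ε / (6 * (M + 1)) := by positivity
  have h0 : 0 < min (1 / 2) (min ε (ε / (6 * (M + 1)))) :=
    lt_min (by norm_num) (lt_min hε hpos)
  refine ⟨_, h0, min_le_left _ _, (min_le_right _ _).trans (min_le_left _ _), ?_⟩
  have h := (min_le_right (1 / 2) (min ε (ε / (6 * (M + 1))))).trans (min_le_right _ _)
  rw [le_div_iff₀ (by positivity)] at h
  linarith

/-- Fix one packing `N j` of each `H j` by `Y` and reuse it in every translate of `H j`. The
frequency of `A` is then close to the `w`-weighted sum of its frequencies in the `H j`, whatever `F`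
is. -/
theorem exists_frequencies {S : Finset Γ} (hsymm : ∀ s ∈ S, s⁻¹ ∈ S)
    (hgen : Subgroup.closure (S : Set Γ) = ⊤) (hamen : IsAmenable S) {Y : Finset (Finset Γ)}
    {δ₀ θ ε : ℝ} (hδ₀ : 0 < δ₀) (hθ : 0 ≤ θ) (hε : 0 < ε)
    (hY : ∀ F : Finset Γ, F.Nonempty → isoperimetric S F < δ₀ →
        ∃ N, Realizes F N ∧ (∀ A, A ∉ Y → N A = 0) ∧
          (1 - θ) * F.card ≤ ∑ A ∈ Y, (N A : ℝ) * A.card) :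
    ∃ (p : Finset Γ → ℝ) (δ : ℝ), 0 < δ ∧ (∀ A, 0 ≤ p A) ∧
      1 - (θ + ε) ≤ ∑ A ∈ Y, p A ∧ ∑ A ∈ Y, p A ≤ 1 ∧
      ∀ F : Finset Γ, F.Nonempty → isoperimetric S F < δ →
        ∃ N, Realizes F N ∧ (∀ A, A ∉ Y → N A = 0) ∧
          ∑ A ∈ Y, |(N A : ℝ) * A.card / F.card - p A| ≤ ε := by
  set M : ℝ := ∑ A ∈ Y, (A.card : ℝ) with hM
  have hM0 : 0 ≤ M := Finset.sum_nonneg fun _ _ => Nat.cast_nonneg _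
  obtain ⟨η, hη0, hη1, hηε, hηM⟩ := exists_pos_le_and_mul_le hM0 hε
  obtain ⟨ι, _, H, w, δ, hδ, hH, hw0, hw1, hw2, hF⟩ := exists_isQuasiTiling
    hsymm hgen hamen hη0 hη1 hδ₀
  choose N hN hNY hNθ using fun j => hY (H j) (hH j).1 (hH j).2
  have hHpos : ∀ j, (0 : ℝ) < (H j).card := fun j => by exact_mod_cast (hH j).1.card_pos
  have hsum : ∑ A ∈ Y, ∑ j, w j * ((N j A : ℝ) * A.card / (H j).card) =
      ∑ j, w j * ((∑ A ∈ Y, (N j A : ℝ) * A.card) / (H j).card) := by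
    rw [Finset.sum_comm]
    refine Finset.sum_congr rfl fun j _ => ?_
    rw [Finset.sum_div, Finset.mul_sum]
  refine ⟨fun A => ∑ j, w j * ((N j A : ℝ) * A.card / (H j).card), δ, hδ,
    fun A => Finset.sum_nonneg fun j _ => mul_nonneg (hw0 j) (by positivity), ?_, ?_,
    fun F hFne hFi => ?_⟩
  · rw [hsum]
    calc 1 - (θ + ε) ≤ (∑ j, w j) * (1 - θ) := by nlinarith
      _ = ∑ j, w j * (1 - θ) := by rw [Finset.sum_mul]
      _ ≤ _ := Finset.sum_le_sum fun j _ => by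
        refine mul_le_mul_of_nonneg_left ?_ (hw0 j)
        rw [le_div_iff₀ (hHpos j)]
        exact hNθ j
  · rw [hsum]
    refine le_trans (Finset.sum_le_sum fun j _ => ?_) hw2
    refine mul_le_of_le_one_right (hw0 j) ?_
    rw [div_le_one (hHpos j)]
    exact_mod_cast (hN j).sum_le Y
  obtain ⟨T, hT⟩ := hF F hFne hFi
  have hfpos : (0 : ℝ) < F.card := by exact_mod_cast hFne.card_pos
  -- The translates overlap, so each copied packing is cut down to its piece, at the cost of at most
  -- `η * (H j).card` tiles of each shape.
  choose N' hN' hNN' using fun q : Σ _ : ι, Γ × Finset Γ =>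
    ((hN q.1).smul q.2.1).restrict (D := q.2.2)
  refine ⟨_, realizes_sum (J := Finset.univ.sigma T) (D := fun q => q.2.2) (N := N') ?_
    hT.pairwiseDisjoint fun q _ => hN' q, ?_, ?_⟩
  · rintro ⟨j, p⟩ hp
    exact hT.subset j p (Finset.mem_sigma.1 hp).2
  · intro A hA
    refine Finset.sum_eq_zero fun q _ => ?_
    have := (hNN' q A).1
    rw [hNY q.1 A hA] at this
    omega
  · have hTH : ∑ j, ((T j).card : ℝ) * (H j).card ≤ 3 * F.card := by
      have h1 : ∑ j, ((T j).card : ℝ) * (H j).card ≤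
          ∑ j, (|((T j).card : ℝ) * (H j).card - w j * F.card| + w j * F.card) :=
        Finset.sum_le_sum fun j _ => by
          linarith [le_abs_self (((T j).card : ℝ) * (H j).card - w j * F.card)]
      rw [Finset.sum_add_distrib, ← Finset.sum_mul] at h1
      nlinarith [hT.weight]
    -- Of the `6 * η`, half is tiles lost to cutting (by `hTH`) and half is the weight error of the
    -- quasi-tiling. The bound is on tile counts; passing to covered points brings in the factor
    -- `M`.
    have hbound : ∀ A, |((∑ q ∈ Finset.univ.sigma T, N' q A : ℕ) : ℝ) -
        (∑ j, w j * ((N j A : ℝ) / (H j).card)) * F.card| ≤ 6 * η * F.card := by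
      intro A
      rw [Finset.sum_sigma, Nat.cast_sum, Finset.sum_mul, ← Finset.sum_sub_distrib]
      calc _ ≤ ∑ j, |((∑ p ∈ T j, N' ⟨j, p⟩ A : ℕ) : ℝ) -
            w j * ((N j A : ℝ) / (H j).card) * F.card| := Finset.abs_sum_le_sum_abs _ _
        _ ≤ ∑ j, (η * ((T j).card * (H j).card) +
            |((T j).card : ℝ) * (H j).card - w j * F.card|) := by
          refine Finset.sum_le_sum fun j _ => ?_
          have h1 : |((∑ p ∈ T j, N' ⟨j, p⟩ A : ℕ) : ℝ) - (T j).card * N j A| ≤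
              η * ((T j).card * (H j).card) := by
            rw [Nat.cast_sum, ← nsmul_eq_mul, ← Finset.sum_const, ← Finset.sum_sub_distrib]
            refine (Finset.abs_sum_le_sum_abs _ _).trans ?_
            calc _ ≤ ∑ p ∈ T j, η * ((H j).card : ℝ) := Finset.sum_le_sum fun p hp => ?_
              _ = _ := by rw [Finset.sum_const, nsmul_eq_mul]; ring
            have h2 : (N' ⟨j, p⟩ A : ℝ) ≤ N j A := by exact_mod_cast (hNN' ⟨j, p⟩ A).1
            have h3 : (N j A : ℝ) ≤ N' ⟨j, p⟩ A + (p.1 • H j \ p.2).card := by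
              exact_mod_cast (hNN' ⟨j, p⟩ A).2
            have h4 := hT.card_sdiff j p hp
            rw [abs_le]
            constructor
            · linarith
            · linarith [mul_nonneg hη0.le (hHpos j).le]
          have h5 : |((T j).card : ℝ) * N j A - w j * ((N j A : ℝ) / (H j).card) * F.card| ≤
              |((T j).card : ℝ) * (H j).card - w j * F.card| := by
            have h6 : ((T j).card : ℝ) * N j A - w j * ((N j A : ℝ) / (H j).card) * F.card =
                ((N j A : ℝ) / (H j).card) * ((T j).card * (H j).card - w j * F.card) := by
              field_simp [(hHpos j).ne']
            rw [h6, abs_mul, abs_of_nonneg (by positivity)]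
            refine mul_le_of_le_one_left (abs_nonneg _) ?_
            rw [div_le_one (hHpos j)]
            exact_mod_cast (hN j).le_card A
          exact (abs_sub_le _ _ _).trans (add_le_add h1 h5)
        _ ≤ _ := by
          rw [Finset.sum_add_distrib, ← Finset.mul_sum]
          nlinarith [hT.weight]
    calc _ ≤ ∑ A ∈ Y, 6 * η * (A.card : ℝ) := by
          refine Finset.sum_le_sum fun A _ => ?_
          have h1 : ((∑ q ∈ Finset.univ.sigma T, N' q A : ℕ) : ℝ) * A.card / F.card -
              ∑ j, w j * ((N j A : ℝ) * A.card / (H j).card) =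
              (((∑ q ∈ Finset.univ.sigma T, N' q A : ℕ) : ℝ) -
              (∑ j, w j * ((N j A : ℝ) / (H j).card)) * F.card) * (A.card / F.card) := by
            rw [sub_mul, mul_assoc, mul_div_cancel₀ _ hfpos.ne', Finset.sum_mul, mul_div_assoc]
            congr 1
            refine Finset.sum_congr rfl fun j _ => ?_
            ring
          rw [h1, abs_mul, abs_of_nonneg (a := (A.card : ℝ) / F.card) (by positivity)]
          calc _ ≤ 6 * η * F.card * ((A.card : ℝ) / F.card) :=
                mul_le_mul_of_nonneg_right (hbound A) (by positivity)
            _ = _ := by field_simp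
      _ = 6 * η * M := by rw [← Finset.mul_sum]
      _ ≤ ε := hηM

/-- A finite family of almost invariant sets which tile, up to single points, every sufficiently
invariant set, with frequencies close to `p`. -/
theorem exists_level {S : Finset Γ} (hsymm : ∀ s ∈ S, s⁻¹ ∈ S)
    (hgen : Subgroup.closure (S : Set Γ) = ⊤) (hamen : IsAmenable S) {η : ℝ} (hη : 0 < η) :
    ∃ (Y : Finset (Finset Γ)) (p : Finset Γ → ℝ) (δ : ℝ), 0 < δ ∧
      (∀ A ∈ Y, A.Nonempty ∧ isoperimetric S A < η) ∧ (∀ A, 0 ≤ p A) ∧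
      1 - η ≤ ∑ A ∈ Y, p A ∧ ∑ A ∈ Y, p A ≤ 1 ∧
      ∀ F : Finset Γ, F.Nonempty → isoperimetric S F < δ →
        ∃ N, Realizes F N ∧ (∀ A, A ∉ Y → N A = 0) ∧
          ∑ A ∈ Y, |(N A : ℝ) * A.card / F.card - p A| ≤ η := by
  obtain ⟨Y, δ₀, hδ₀, hY, hF⟩ := exists_shapes hsymm hgen hamen (half_pos hη)
  obtain ⟨p, δ, hδ, hp, h1, h2, h3⟩ := exists_frequencies hsymm hgen hamen hδ₀
    (half_pos hη).le (half_pos hη) hF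
  refine ⟨Y, p, δ, hδ, fun A hA => ⟨(hY A hA).1, (hY A hA).2.trans (half_lt_self hη)⟩, hp,
    by linarith, h2, fun F hFne hFi => ?_⟩
  obtain ⟨N, hN, hNY, hNp⟩ := h3 F hFne hFi
  exact ⟨N, hN, hNY, hNp.trans (half_le_self hη.le)⟩

end Bratteli

namespace Bratteli

/-! ### Contraction of measures along the levels, and reachable states. -/

section Markov

variable {α : Type*}

/-- A sequence of substochastic matrices `v n`, from the finite set `Y (n + 1)` to `Y n`, all of
whose rows at stage `n` are close to `p n`. -/
structure IsContracting (Y : ℕ → Finset α) (v : ℕ → α → α → ℝ) (p : ℕ → α → ℝ) : Prop where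
  nonneg : ∀ n B A, 0 ≤ v n B A
  sum_le_one : ∀ n, ∀ B ∈ Y (n + 1), ∑ A ∈ Y n, v n B A ≤ 1
  weight_nonneg : ∀ n A, 0 ≤ p n A
  weight_sum_ge : ∀ n, 1 - (1 / 2) ^ (n + 3) ≤ ∑ A ∈ Y n, p n A
  weight_sum_le : ∀ n, ∑ A ∈ Y n, p n A ≤ 1
  row_close : ∀ n, ∀ B ∈ Y (n + 1), ∑ A ∈ Y n, |v n B A - p n A| ≤ (1 / 2) ^ (n + 3)

/-- The image of the measure `π` on `Y (n + 1)` under `v n`. -/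
def pushDown (Y : ℕ → Finset α) (v : ℕ → α → α → ℝ) (n : ℕ) (π : α → ℝ) (A : α) : ℝ :=
  ∑ B ∈ Y (n + 1), v n B A * π B

/-- The image on `Y n` of the measure `p (n + k)`. -/
def pushWeight (Y : ℕ → Finset α) (v : ℕ → α → α → ℝ) (p : ℕ → α → ℝ) : ℕ → ℕ → α → ℝ
  | n, 0 => p n
  | n, k + 1 => pushDown Y v n (pushWeight Y v p (n + 1) k)

namespace IsContracting

variable {Y : ℕ → Finset α} {v : ℕ → α → α → ℝ} {p : ℕ → α → ℝ}

theorem sum_abs_pushDown_sub_le (h : IsContracting Y v p) (n : ℕ) (π π' : α → ℝ) :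
    ∑ A ∈ Y n, |pushDown Y v n π A - pushDown Y v n π' A| ≤ ∑ B ∈ Y (n + 1), |π B - π' B| := by
  calc _ ≤ ∑ A ∈ Y n, ∑ B ∈ Y (n + 1), v n B A * |π B - π' B| := by
        refine Finset.sum_le_sum fun A _ => ?_
        rw [pushDown, pushDown, ← Finset.sum_sub_distrib]
        refine (Finset.abs_sum_le_sum_abs _ _).trans_eq (Finset.sum_congr rfl fun B _ => ?_)
        rw [← mul_sub, abs_mul, abs_of_nonneg (h.nonneg n B A)]
    _ = ∑ B ∈ Y (n + 1), (∑ A ∈ Y n, v n B A) * |π B - π' B| := by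
        rw [Finset.sum_comm]
        simp_rw [Finset.sum_mul]
    _ ≤ _ := Finset.sum_le_sum fun B hB =>
        mul_le_of_le_one_left (abs_nonneg _) (h.sum_le_one n B hB)

theorem sum_pushDown_le (h : IsContracting Y v p) (n : ℕ) {π : α → ℝ} (hπ : ∀ B, 0 ≤ π B) :
    ∑ A ∈ Y n, pushDown Y v n π A ≤ ∑ B ∈ Y (n + 1), π B := by
  simp_rw [pushDown]
  rw [Finset.sum_comm]
  refine Finset.sum_le_sum fun B hB => ?_
  rw [← Finset.sum_mul]
  exact mul_le_of_le_one_left (hπ B) (h.sum_le_one n B hB)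

/-- Since every row is close to `p n`, so is any average of rows. The row error `(1 / 2) ^ (n + 3)`
and the mass missing from `p (n + 1)`, at most `(1 / 2) ^ (n + 4)`, add up to less than the bound.
-/
theorem sum_abs_pushDown_weight_sub_le (h : IsContracting Y v p) (n : ℕ) :
    ∑ A ∈ Y n, |pushDown Y v n (p (n + 1)) A - p n A| ≤ (1 / 2) ^ (n + 2) := by
  set s := ∑ B ∈ Y (n + 1), p (n + 1) B with hs
  have hs1 : 1 - (1 / 2) ^ (n + 4) ≤ s := h.weight_sum_ge (n + 1)
  have hs2 : s ≤ 1 := h.weight_sum_le (n + 1)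
  have hs0 : 0 ≤ s := Finset.sum_nonneg fun B _ => h.weight_nonneg _ B
  calc _ ≤ ∑ A ∈ Y n, ((∑ B ∈ Y (n + 1), |v n B A - p n A| * p (n + 1) B) +
          (1 - s) * p n A) := by
        refine Finset.sum_le_sum fun A _ => ?_
        have h1 : pushDown Y v n (p (n + 1)) A - p n A =
            (∑ B ∈ Y (n + 1), (v n B A - p n A) * p (n + 1) B) - (1 - s) * p n A := by
          simp_rw [sub_mul, Finset.sum_sub_distrib, ← Finset.mul_sum]
          rw [pushDown]
          ring
        rw [h1]
        refine (abs_sub _ _).trans (add_le_add ?_ ?_)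
        · refine (Finset.abs_sum_le_sum_abs _ _).trans_eq (Finset.sum_congr rfl fun B _ => ?_)
          rw [abs_mul, abs_of_nonneg (h.weight_nonneg (n + 1) B)]
        · rw [abs_of_nonneg (mul_nonneg (by linarith) (h.weight_nonneg n A))]
    _ = ∑ B ∈ Y (n + 1), (∑ A ∈ Y n, |v n B A - p n A|) * p (n + 1) B +
          (1 - s) * ∑ A ∈ Y n, p n A := by
        rw [Finset.sum_add_distrib, Finset.sum_comm, Finset.mul_sum]
        simp_rw [Finset.sum_mul]
    _ ≤ ∑ B ∈ Y (n + 1), (1 / 2) ^ (n + 3) * p (n + 1) B + (1 - s) * 1 := by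
        refine add_le_add (Finset.sum_le_sum fun B hB => ?_)
          (mul_le_mul_of_nonneg_left (h.weight_sum_le n) (by linarith))
        exact mul_le_mul_of_nonneg_right (h.row_close n B hB) (h.weight_nonneg _ B)
    _ ≤ _ := by
        rw [← Finset.mul_sum, ← hs]
        have h2 : (0 : ℝ) < (1 / 2) ^ n := by positivity
        simp only [pow_add] at hs1 ⊢
        nlinarith

/-- The discrepancy arises at level `n + k`, and pushing it down `k` levels does not increase its ℓ¹
norm. -/
theorem sum_abs_pushWeight_succ_sub_le (h : IsContracting Y v p) (k : ℕ) : ∀ n,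
    ∑ A ∈ Y n, |pushWeight Y v p n (k + 1) A - pushWeight Y v p n k A| ≤
      (1 / 2) ^ (n + 2) * (1 / 2) ^ k := by
  induction k with
  | zero =>
    intro n
    simpa [pushWeight] using h.sum_abs_pushDown_weight_sub_le n
  | succ k ih =>
    intro n
    refine (h.sum_abs_pushDown_sub_le n _ _).trans ((ih (n + 1)).trans_eq ?_)
    ring

theorem pushWeight_nonneg (h : IsContracting Y v p) (k : ℕ) :
    ∀ n A, 0 ≤ pushWeight Y v p n k A := by
  induction k with
  | zero => exact h.weight_nonneg
  | succ k ih =>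
    exact fun n A => Finset.sum_nonneg fun B _ => mul_nonneg (h.nonneg n B A) (ih (n + 1) B)

theorem sum_pushWeight_le (h : IsContracting Y v p) (k : ℕ) :
    ∀ n, ∑ A ∈ Y n, pushWeight Y v p n k A ≤ 1 := by
  induction k with
  | zero => exact h.weight_sum_le
  | succ k ih =>
    exact fun n => (h.sum_pushDown_le n (h.pushWeight_nonneg k (n + 1))).trans (ih (n + 1))

theorem sum_pushWeight_ge (h : IsContracting Y v p) (n k : ℕ) :
    1 - (1 / 2) ^ n ≤ ∑ A ∈ Y n, pushWeight Y v p n k A := by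
  -- Here `2 - 2 * (1 / 2) ^ k` is the sum of the first `k` terms of the geometric series bounding
  -- the successive differences.
  have key : ∀ k, ∑ A ∈ Y n, p n A - (1 / 2) ^ (n + 2) * (2 - 2 * (1 / 2) ^ k) ≤
      ∑ A ∈ Y n, pushWeight Y v p n k A := by
    intro k
    induction k with
    | zero => simp [pushWeight]
    | succ k ih =>
      have h1 := h.sum_abs_pushWeight_succ_sub_le k n
      have h2 := Finset.abs_sum_le_sum_abs (s := Y n)
        (fun A => pushWeight Y v p n (k + 1) A - pushWeight Y v p n k A)
      rw [Finset.sum_sub_distrib] at h2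
      have h3 := neg_le_of_abs_le (h2.trans h1)
      rw [pow_succ (1 / 2 : ℝ) k]
      linarith
  have h1 := key k
  have h2 := h.weight_sum_ge n
  have h3 : (0 : ℝ) < (1 / 2) ^ n := by positivity
  have h4 : (0 : ℝ) < (1 / 2) ^ k := by positivity
  simp only [pow_add] at h1 h2
  nlinarith [mul_pos h3 h4]

theorem exists_tendsto (h : IsContracting Y v p) :
    ∃ m : ℕ → α → ℝ, ∀ n, ∀ A ∈ Y n,
      Tendsto (fun k => pushWeight Y v p n k A) atTop (𝓝 (m n A)) := by
  have key : ∀ n A, ∃ x, A ∈ Y n → Tendsto (fun k => pushWeight Y v p n k A) atTop (𝓝 x) := by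
    intro n A
    by_cases hA : A ∈ Y n
    · have hc : CauchySeq fun k => pushWeight Y v p n k A := by
        refine cauchySeq_of_le_geometric (1 / 2) ((1 / 2) ^ (n + 2)) (by norm_num) fun k => ?_
        rw [dist_comm, Real.dist_eq]
        exact (Finset.single_le_sum (f := fun A =>
          |pushWeight Y v p n (k + 1) A - pushWeight Y v p n k A|) (fun _ _ => abs_nonneg _)
          hA).trans (h.sum_abs_pushWeight_succ_sub_le k n)
      obtain ⟨x, hx⟩ := cauchySeq_tendsto_of_complete hc
      exact ⟨x, fun _ => hx⟩
    · exact ⟨0, fun h => absurd h hA⟩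
  choose m hm using key
  exact ⟨m, hm⟩

end IsContracting

/-- The elements of `Y n` which can be reached from `Y (n + k)`. -/
noncomputable def reachable (Y : ℕ → Finset α) (K : ℕ → α → α → ℕ) : ℕ → ℕ → Finset α
  | n, 0 => Y n
  | n, k + 1 =>
    open Classical in (Y n).filter fun A => ∃ B ∈ reachable Y K (n + 1) k, 0 < K n B A

variable {Y : ℕ → Finset α} {K : ℕ → α → α → ℕ}

theorem mem_reachable_succ {n k : ℕ} {A : α} : A ∈ reachable Y K n (k + 1) ↔
    A ∈ Y n ∧ ∃ B ∈ reachable Y K (n + 1) k, 0 < K n B A := by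
  simp [reachable]

theorem reachable_subset (n k : ℕ) : reachable Y K n k ⊆ Y n := by
  cases k with
  | zero => exact subset_rfl
  | succ k => exact fun A hA => (mem_reachable_succ.1 hA).1

theorem reachable_succ_subset (k : ℕ) : ∀ n, reachable Y K n (k + 1) ⊆ reachable Y K n k := by
  induction k with
  | zero => exact fun n => reachable_subset n 1
  | succ k ih =>
    intro n A hA
    obtain ⟨hA, B, hB, hK⟩ := mem_reachable_succ.1 hA
    exact mem_reachable_succ.2 ⟨hA, B, ih (n + 1) hB, hK⟩

/-- A decreasing sequence of finite sets is constant from the point where its cardinality is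
minimal. -/
theorem exists_reachable_eq (Y : ℕ → Finset α) (K : ℕ → α → α → ℕ) (n : ℕ) :
    ∃ X : Finset α, ∀ᶠ k in atTop, reachable Y K n k = X := by
  have hanti : Antitone (reachable Y K n) :=
    antitone_nat_of_succ_le fun k => reachable_succ_subset k n
  refine ⟨reachable Y K n (Function.argmin fun k => (reachable Y K n k).card), ?_⟩
  filter_upwards [eventually_ge_atTop (Function.argmin fun k => (reachable Y K n k).card)]
    with k hk
  exact Finset.eq_of_subset_of_card_le (hanti hk)
    (not_lt.1 (Function.not_lt_argmin (fun k => (reachable Y K n k).card) k))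

theorem pushWeight_eq_zero {v : ℕ → α → α → ℝ} {p : ℕ → α → ℝ}
    (hv : ∀ n B A, K n B A = 0 → v n B A = 0) (k : ℕ) : ∀ n, ∀ A ∈ Y n,
    A ∉ reachable Y K n k → pushWeight Y v p n k A = 0 := by
  induction k with
  | zero => exact fun n A hA hA' => absurd hA hA'
  | succ k ih =>
    intro n A hA hA'
    refine Finset.sum_eq_zero fun B hB => ?_
    by_cases hB' : B ∈ reachable Y K (n + 1) k
    · rw [hv n B A, zero_mul]
      by_contra hK
      exact hA' (mem_reachable_succ.2 ⟨hA, B, hB', Nat.pos_of_ne_zero hK⟩)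
    · rw [ih (n + 1) B hB hB', mul_zero]

end Markov

variable {Γ : Type*} [Group Γ] [DecidableEq Γ]

/-! ### Systems of shapes, refinement and pruning. -/

theorem Realizes.refine {F : Finset Γ} {N : Finset Γ → ℕ} {Y : Finset (Finset Γ)}
    {K : Finset Γ → Finset Γ → ℕ} (h : Realizes F N) (hY : ∀ B, B ∉ Y → N B = 0)
    (hK : ∀ B ∈ Y, Realizes B (K B)) : Realizes F fun A => ∑ B ∈ Y, N B * K B A := by
  obtain ⟨T, hT, hN⟩ := h
  have hTY : ∀ p ∈ T, p.2 ∈ Y := by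
    intro p hp
    by_contra hpY
    have := hN p.2
    rw [hY _ hpY, Finset.card_eq_zero] at this
    exact Finset.notMem_empty p (this ▸ Finset.mem_filter.2 ⟨hp, rfl⟩)
  have h1 := realizes_sum (J := T) (D := fun p => p.1 • p.2) (N := fun p => K p.2) hT.subset
    hT.disjoint fun p hp => (hK p.2 (hTY p hp)).smul p.1
  convert h1 using 2 with A
  rw [← Finset.sum_fiberwise_of_maps_to hTY]
  refine Finset.sum_congr rfl fun B _ => ?_
  rw [Finset.sum_congr rfl (g := fun _ => K B A)
    fun p hp => by rw [(Finset.mem_filter.1 hp).2], Finset.sum_const, hN, smul_eq_mul]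

/-- A sequence of families of shapes, the shapes of each family being packed by those of the
previous one. -/
structure IsShapeSystem (S : Finset Γ) (Y : ℕ → Finset (Finset Γ)) (p : ℕ → Finset Γ → ℝ)
    (K : ℕ → Finset Γ → Finset Γ → ℕ) : Prop where
  nonempty : ∀ n, ∀ A ∈ Y n, A.Nonempty
  isoperimetric_le : ∀ n, ∀ A ∈ Y n, isoperimetric S A ≤ 1 / 2 ^ n
  realizes : ∀ n, ∀ B ∈ Y (n + 1), Realizes B (K n B)
  eq_zero : ∀ n, ∀ B ∈ Y (n + 1), ∀ A, A ∉ Y n → K n B A = 0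
  weight_nonneg : ∀ n A, 0 ≤ p n A
  weight_sum_ge : ∀ n, 1 - (1 / 2) ^ (n + 3) ≤ ∑ A ∈ Y n, p n A
  weight_sum_le : ∀ n, ∑ A ∈ Y n, p n A ≤ 1
  close : ∀ n, ∀ B ∈ Y (n + 1),
    ∑ A ∈ Y n, |(K n B A : ℝ) * A.card / B.card - p n A| ≤ (1 / 2) ^ (n + 3)
  exists_close : ∀ n, ∃ δ : ℝ, 0 < δ ∧ ∀ F : Finset Γ, F.Nonempty → isoperimetric S F < δ →
    ∃ N, Realizes F N ∧ (∀ A, A ∉ Y n → N A = 0) ∧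
      ∑ A ∈ Y n, |(N A : ℝ) * A.card / F.card - p n A| ≤ (1 / 2) ^ (n + 3)

theorem exists_isShapeSystem {S : Finset Γ} (hsymm : ∀ s ∈ S, s⁻¹ ∈ S)
    (hgen : Subgroup.closure (S : Set Γ) = ⊤) (hamen : IsAmenable S) :
    ∃ Y p K, IsShapeSystem S Y p K := by
  choose Y p δ hδ hY hp hp1 hp2 hF using
    fun η : Set.Ioi (0 : ℝ) => exists_level hsymm hgen hamen η.2
  -- The tolerance of level `n + 1` is below the threshold `δ` of level `n`, so the shapes of level
  -- `n + 1` are themselves sets that level `n` can pack.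
  let e : ℕ → Set.Ioi (0 : ℝ) := fun n => Nat.rec ⟨(1 / 2) ^ 3, Set.mem_Ioi.2 (by positivity)⟩
    (fun n x => ⟨min ((1 / 2) ^ (n + 4)) (δ x), lt_min (by positivity) (hδ x)⟩) n
  have he1 : ∀ n, (e n).1 ≤ (1 / 2) ^ (n + 3) := by
    rintro (_ | n)
    · exact le_of_eq (by simp [e])
    · exact min_le_left _ _
  have he2 : ∀ n, (e (n + 1)).1 ≤ δ (e n) := fun n => min_le_right _ _
  have hK : ∀ n B, ∃ N : Finset Γ → ℕ,
      (B ∈ Y (e (n + 1)) → Realizes B N ∧ (∀ A, A ∉ Y (e n) → N A = 0) ∧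
        ∑ A ∈ Y (e n), |(N A : ℝ) * A.card / B.card - p (e n) A| ≤ (e n).1) := by
    intro n B
    by_cases hB : B ∈ Y (e (n + 1))
    · obtain ⟨N, hN⟩ := hF (e n) B (hY _ B hB).1 ((hY _ B hB).2.trans_le (he2 n))
      exact ⟨N, fun _ => hN⟩
    · exact ⟨fun _ => 0, fun h => absurd h hB⟩
  choose K hK using hK
  refine ⟨fun n => Y (e n), fun n => p (e n), K, fun n A hA => (hY _ A hA).1, fun n A hA => ?_,
    fun n B hB => (hK n B hB).1, fun n B hB => (hK n B hB).2.1, fun n => hp (e n),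
    fun n => ?_, fun n => hp2 (e n), fun n B hB => (hK n B hB).2.2.trans (he1 n),
    fun n => ⟨δ (e n), hδ _, fun F hFne hFi => ?_⟩⟩
  · refine (hY _ A hA).2.le.trans ((he1 n).trans ?_)
    rw [← one_div_pow]
    exact pow_le_pow_of_le_one (by norm_num) (by norm_num) (by omega)
  · linarith [hp1 (e n), he1 n]
  · obtain ⟨N, hN, hNY, hNp⟩ := hF (e n) F hFne hFi
    exact ⟨N, hN, hNY, hNp.trans (he1 n)⟩

namespace IsShapeSystem

variable {S : Finset Γ} {Y : ℕ → Finset (Finset Γ)} {p : ℕ → Finset Γ → ℝ}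
  {K : ℕ → Finset Γ → Finset Γ → ℕ}

theorem isContracting (h : IsShapeSystem S Y p K) :
    IsContracting Y (fun n B A => (K n B A : ℝ) * A.card / B.card) p where
  nonneg n B A := by positivity
  sum_le_one n B hB := by
    rw [← Finset.sum_div]
    refine div_le_one_of_le₀ ?_ (Nat.cast_nonneg _)
    exact_mod_cast (h.realizes n B hB).sum_le (Y n)
  weight_nonneg := h.weight_nonneg
  weight_sum_ge := h.weight_sum_ge
  weight_sum_le := h.weight_sum_le
  row_close := h.close

/-- Replacing each tile by its own packing turns the frequencies on level `n + 1` into their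
`pushDown`, which is an ℓ¹ contraction; the error `e` of the deep level survives unchanged. -/
theorem exists_realizes_reachable (h : IsShapeSystem S Y p K) {F : Finset Γ} {e : ℝ} (k : ℕ) :
    ∀ n, (∃ N, Realizes F N ∧ (∀ A, A ∉ Y (n + k) → N A = 0) ∧
      ∑ A ∈ Y (n + k), |(N A : ℝ) * A.card / F.card - p (n + k) A| ≤ e) →
    ∃ N, Realizes F N ∧ (∀ A, A ∉ reachable Y K n k → N A = 0) ∧
      ∑ A ∈ Y n, |(N A : ℝ) * A.card / F.card -
        pushWeight Y (fun n B A => (K n B A : ℝ) * A.card / B.card) p n k A| ≤ e := by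
  induction k with
  | zero => exact fun n hN => hN
  | succ k ih =>
    intro n hN
    rw [show n + (k + 1) = n + 1 + k by omega] at hN
    obtain ⟨N, hN, hNY, hNp⟩ := ih (n + 1) hN
    refine ⟨_, hN.refine (Y := Y (n + 1)) (K := K n)
      (fun B hB => hNY B fun hB' => hB (reachable_subset _ _ hB')) (h.realizes n), ?_, ?_⟩
    · intro A hA
      refine Finset.sum_eq_zero fun B hB => ?_
      by_contra hne
      have hN0 : N B ≠ 0 := left_ne_zero_of_mul hne
      have hK0 : K n B A ≠ 0 := right_ne_zero_of_mul hne
      refine hA (mem_reachable_succ.2 ⟨?_, B, ?_, Nat.pos_of_ne_zero hK0⟩)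
      · by_contra hA'
        exact hK0 (h.eq_zero n B hB A hA')
      · by_contra hB'
        exact hN0 (hNY B hB')
    · refine le_trans (le_of_eq ?_) ((h.isContracting.sum_abs_pushDown_sub_le n
        (fun B => (N B : ℝ) * B.card / F.card) _).trans hNp)
      refine Finset.sum_congr rfl fun A _ => ?_
      rw [pushWeight]
      congr 2
      rw [pushDown, Nat.cast_sum, Finset.sum_mul, Finset.sum_div]
      refine Finset.sum_congr rfl fun B hB => ?_
      have hBpos : (B.card : ℝ) ≠ 0 := by exact_mod_cast (h.nonempty _ B hB).card_pos.ne'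
      rw [Nat.cast_mul]
      field_simp

end IsShapeSystem

/-- A system of shapes in which every shape is used in the next family, together with a harmonic
function. -/
structure IsPrunedSystem (S : Finset Γ) (X : ℕ → Finset (Finset Γ))
    (K : ℕ → Finset Γ → Finset Γ → ℕ) (m : ℕ → Finset Γ → ℝ) : Prop where
  nonempty : ∀ n, ∀ A ∈ X n, A.Nonempty
  isoperimetric_le : ∀ n, ∀ A ∈ X n, isoperimetric S A ≤ 1 / 2 ^ n
  realizes : ∀ n, ∀ B ∈ X (n + 1), Realizes B (K n B)
  eq_zero : ∀ n, ∀ B ∈ X (n + 1), ∀ A, A ∉ X n → K n B A = 0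
  exists_pos : ∀ n, ∀ A ∈ X n, ∃ B ∈ X (n + 1), 0 < K n B A
  sum_ge : ∀ n, ∀ B ∈ X (n + 1),
    (1 - 1 / 2 ^ n) * (B.card : ℝ) ≤ ∑ A ∈ X n, (K n B A : ℝ) * A.card
  harmonic_nonneg : ∀ n, ∀ A ∈ X n, 0 ≤ m n A
  harmonic : ∀ n, ∀ A ∈ X n,
    m n A = ∑ B ∈ X (n + 1), (K n B A : ℝ) * A.card / B.card * m (n + 1) B
  harmonic_sum_le : ∀ n, ∑ A ∈ X n, m n A ≤ 1
  harmonic_sum_ge : ∀ n, 1 - (1 / 2) ^ n ≤ ∑ A ∈ X n, m n A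
  exists_close : ∀ n, ∀ ε : ℝ, 0 < ε → ∃ δ : ℝ, 0 < δ ∧
    ∀ F : Finset Γ, F.Nonempty → isoperimetric S F < δ →
      ∃ N, Realizes F N ∧ (∀ A, A ∉ X n → N A = 0) ∧
        ∑ A ∈ X n, |(N A : ℝ) * A.card / F.card - m n A| < ε

theorem IsShapeSystem.exists_isPrunedSystem {S : Finset Γ} {Y : ℕ → Finset (Finset Γ)}
    {p : ℕ → Finset Γ → ℝ} {K : ℕ → Finset Γ → Finset Γ → ℕ} (h : IsShapeSystem S Y p K) :
    ∃ X m, IsPrunedSystem S X K m := by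
  have hc := h.isContracting
  obtain ⟨m, hm⟩ := hc.exists_tendsto
  choose X hX using exists_reachable_eq Y K
  have hXY : ∀ n, X n ⊆ Y n := fun n => by
    obtain ⟨k, hk⟩ := (hX n).exists
    exact hk ▸ reachable_subset n k
  -- One large `k` for which `k + 1` steps above `n` and `k` steps above `n + 1` have both
  -- stabilised turns the recursion for `reachable` into one for `X`.
  have hXsucc : ∀ n A, A ∈ X n ↔ A ∈ Y n ∧ ∃ B ∈ X (n + 1), 0 < K n B A := fun n A => by
    obtain ⟨k, hk1, hk2⟩ :=
      (((tendsto_add_atTop_nat 1).eventually (hX n)).and (hX (n + 1))).exists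
    rw [← hk1, ← hk2, mem_reachable_succ]
  have hKX : ∀ n, ∀ B ∈ X (n + 1), ∀ A, A ∉ X n → K n B A = 0 := by
    intro n B hB A hA
    by_contra hK
    refine hA ((hXsucc n A).2 ⟨?_, B, hB, Nat.pos_of_ne_zero hK⟩)
    by_contra hA'
    exact hK (h.eq_zero n B (hXY _ hB) A hA')
  have hm0 : ∀ n, ∀ A ∈ Y n, A ∉ X n → m n A = 0 := by
    intro n A hA hA'
    refine tendsto_nhds_unique (hm n A hA) (tendsto_const_nhds.congr' ?_)
    filter_upwards [hX n] with k hk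
    rw [pushWeight_eq_zero (K := K) (fun n B A hK => by simp [hK]) k n A hA (hk ▸ hA')]
  have hmsum : ∀ n, ∑ A ∈ X n, m n A = ∑ A ∈ Y n, m n A := fun n =>
    Finset.sum_subset (hXY n) (hm0 n)
  have hlim : ∀ n, Tendsto (fun k => ∑ A ∈ Y n, pushWeight Y
      (fun n B A => (K n B A : ℝ) * A.card / B.card) p n k A) atTop (𝓝 (∑ A ∈ Y n, m n A)) :=
    fun n => tendsto_finsetSum _ fun A hA => hm n A hA
  refine ⟨X, m, fun n A hA => h.nonempty n A (hXY n hA),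
    fun n A hA => h.isoperimetric_le n A (hXY n hA),
    fun n B hB => h.realizes n B (hXY _ hB), hKX, fun n A hA => ((hXsucc n A).1 hA).2, ?_, ?_, ?_,
    ?_, ?_, ?_⟩
  · intro n B hB
    have hBY := hXY _ hB
    have hBpos : (0 : ℝ) < B.card := by exact_mod_cast (h.nonempty _ B hBY).card_pos
    have h1 : ∑ A ∈ X n, (K n B A : ℝ) * A.card = ∑ A ∈ Y n, (K n B A : ℝ) * A.card :=
      Finset.sum_subset (hXY n) fun A _ hA => by rw [hKX n B hB A hA, Nat.cast_zero, zero_mul]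
    rw [h1, ← le_div_iff₀ hBpos, Finset.sum_div]
    have h2 := (Finset.abs_sum_le_sum_abs _ _).trans (h.close n B hBY)
    rw [Finset.sum_sub_distrib] at h2
    have h3 := neg_le_of_abs_le h2
    have h4 := h.weight_sum_ge n
    have h5 : (0 : ℝ) < (1 / 2) ^ n := by positivity
    rw [← one_div_pow]
    simp only [pow_add] at h3 h4
    linarith
  · exact fun n A hA => ge_of_tendsto' (hm n A (hXY n hA)) fun k => hc.pushWeight_nonneg k n A
  -- Harmonicity is the limit of the recursion for `pushWeight`; shapes outside `X (n + 1)` drop out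
  -- because their limit mass is zero.
  · intro n A hA
    have h1 := (hm n A (hXY n hA)).comp (tendsto_add_atTop_nat 1)
    have h2 := tendsto_nhds_unique h1 (tendsto_finsetSum (Y (n + 1)) fun B hB =>
      (hm (n + 1) B hB).const_mul ((K n B A : ℝ) * A.card / B.card))
    rw [h2]
    exact (Finset.sum_subset (hXY (n + 1)) fun B hB hB' => by
      rw [hm0 (n + 1) B hB hB', mul_zero]).symm
  · intro n
    rw [hmsum]
    exact le_of_tendsto' (hlim n) fun k => hc.sum_pushWeight_le k n
  · intro n
    rw [hmsum]
    exact ge_of_tendsto' (hlim n) fun k => hc.sum_pushWeight_ge n k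
  · intro n ε hε
    have h1 : Tendsto (fun k => ∑ A ∈ Y n, |pushWeight Y
        (fun n B A => (K n B A : ℝ) * A.card / B.card) p n k A - m n A|) atTop (𝓝 0) := by
      have := tendsto_finsetSum (Y n) fun A hA => ((hm n A hA).sub_const (m n A)).abs
      simpa using this
    have h2 : Tendsto (fun k : ℕ => (1 / 2 : ℝ) ^ (n + k + 3)) atTop (𝓝 0) :=
      (tendsto_pow_atTop_nhds_zero_of_lt_one (by norm_num) (by norm_num)).comp
        (tendsto_atTop_mono (fun k => show k ≤ n + k + 3 by omega) tendsto_id)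
    -- The depth `k` depends on `ε`: only stable shapes are used, the pushed weights are within `ε /
    -- 2` of `m n`, and the tolerance of level `n + k` is below `ε / 2`.
    obtain ⟨k, hk1, hk2, hk3⟩ := ((hX n).and ((h1.eventually (gt_mem_nhds (half_pos hε))).and
      (h2.eventually (gt_mem_nhds (half_pos hε))))).exists
    obtain ⟨δ, hδ, hF⟩ := h.exists_close (n + k)
    refine ⟨δ, hδ, fun F hFne hFi => ?_⟩
    obtain ⟨N, hN, hNX, hNp⟩ := h.exists_realizes_reachable k n (hF F hFne hFi)
    refine ⟨N, hN, fun A hA => hNX A (hk1 ▸ hA), ?_⟩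
    calc _ ≤ ∑ A ∈ Y n, |(N A : ℝ) * A.card / F.card - m n A| :=
          Finset.sum_le_sum_of_subset_of_nonneg (hXY n) fun _ _ _ => abs_nonneg _
      _ ≤ _ := Finset.sum_le_sum fun A _ => abs_sub_le _ (pushWeight Y
        (fun n B A => (K n B A : ℝ) * A.card / B.card) p n k A) _
      _ < ε := by
        rw [Finset.sum_add_distrib]
        linarith

/-! ### From packings to tilings. -/

theorem IsTiling.card_covered {ι : Type*} [DecidableEq ι] {A : ι → Finset Γ}
    {T : Finset (Γ × ι)} {F : Finset Γ} (h : IsTiling A T F) (L : ι) :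
    (covered A T L).card = (T.filter fun p => p.2 = L).card * (A L).card := by
  rw [covered, Finset.card_biUnion (h.disjoint.subset
    (by exact_mod_cast Finset.filter_subset _ _)),
    Finset.sum_congr rfl (g := fun _ => (A L).card) fun p hp => by
      rw [Finset.card_smul_finset, (Finset.mem_filter.1 hp).2], Finset.sum_const, smul_eq_mul]

/-- The finite set belonging to a shape in `X`, or to the single point `none`. -/
def tileOf (X : Finset (Finset Γ)) : Option X → Finset Γ
  | some A => A.1
  | none => {1}

theorem TileData.tile_eq_tileOf {Γ : Type*} [Group Γ] (Z : TileData Γ) (n : ℕ) : Z.tile n = tileOf (Z.shapes n) := by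
  funext A
  cases A <;> rfl

/-- Each uncovered point becomes a tile labelled `none`. The label keeps these apart from shapes
that happen to be singletons, and their number follows by comparing sizes. -/
theorem Realizes.exists_isTiling {F : Finset Γ} {N : Finset Γ → ℕ} {X : Finset (Finset Γ)}
    (h : Realizes F N) (hX : ∀ A, A ∉ X → N A = 0) :
    ∃ T : Finset (Γ × Option X), IsTiling (tileOf X) T F ∧
      (∀ A : X, (T.filter fun p => p.2 = some A).card = N A) ∧
      ((T.filter fun p => p.2 = none).card : ℝ) =
        F.card - ∑ A ∈ X, (N A : ℝ) * A.card := by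
  obtain ⟨T, hT, hN⟩ := h
  have hTX : ∀ p ∈ T, p.2 ∈ X := by
    intro p hp
    by_contra hpX
    have := hN p.2
    rw [hX _ hpX, Finset.card_eq_zero] at this
    exact Finset.notMem_empty p (this ▸ Finset.mem_filter.2 ⟨hp, rfl⟩)
  set V := T.biUnion fun p => p.1 • p.2 with hV
  set T₁ : Finset (Γ × Option X) :=
    X.attach.biUnion fun A => (T.filter fun p => p.2 = A.1).image fun p => (p.1, some A) with hT₁
  set T₂ : Finset (Γ × Option X) := (F \ V).image fun x => (x, none) with hT₂
  have hmem₁ : ∀ (c : Γ) (A : X), (c, some A) ∈ T₁ ↔ (c, A.1) ∈ T := by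
    intro c A
    simp only [hT₁, Finset.mem_biUnion, Finset.mem_image, Finset.mem_filter, Finset.mem_attach,
      true_and, Prod.mk.injEq, Option.some.injEq]
    constructor
    · rintro ⟨B, ⟨a, C⟩, ⟨hp, hB⟩, rfl, rfl⟩
      exact hB ▸ hp
    · exact fun hp => ⟨A, (c, A.1), ⟨hp, rfl⟩, rfl, rfl⟩
  have hmem₁' : ∀ c : Γ, (c, none) ∉ T₁ := by simp [hT₁]
  have hmem₂ : ∀ c : Γ, (c, none) ∈ T₂ ↔ c ∈ F \ V := by simp [hT₂]
  have hmem₂' : ∀ (c : Γ) (A : X), (c, some A) ∉ T₂ := by simp [hT₂]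
  have htile : IsTiling (tileOf X) (T₁ ∪ T₂) F := by
    refine ⟨?_, ?_⟩
    · have hd : ∀ (c : Γ) (A : X) (x : Γ), (c, A.1) ∈ T → x ∈ F \ V →
          Disjoint (c • A.1) (x • ({1} : Finset Γ)) := by
        intro c A x hc hx
        rw [Finset.smul_finset_singleton, smul_eq_mul, mul_one, Finset.disjoint_singleton_right]
        exact fun hx' => (Finset.mem_sdiff.1 hx).2 (Finset.mem_biUnion.2 ⟨_, hc, hx'⟩)
      rintro ⟨c, _ | A⟩ hp ⟨d, _ | B⟩ hq hne <;>
        simp only [Finset.coe_union, Set.mem_union, Finset.mem_coe, hmem₁, hmem₁', hmem₂,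
          hmem₂', false_or, or_false] at hp hq
      · simp only [Function.onFun, tileOf, Finset.smul_finset_singleton, smul_eq_mul, mul_one,
          Finset.disjoint_singleton]
        exact fun h => hne (by rw [h])
      · exact (hd d B c hq hp).symm
      · exact hd c A d hp hq
      · refine hT.disjoint hp hq fun h => hne ?_
        rw [Prod.mk.injEq] at h
        rw [h.1, Subtype.ext h.2]
    · ext x
      simp only [Finset.mem_biUnion, Prod.exists, Option.exists, Finset.mem_union, hmem₁, hmem₁',
        hmem₂, hmem₂', false_or, or_false, tileOf]
      constructor
      · rintro ⟨c, ⟨hc, hx⟩ | ⟨A, hc, hx⟩⟩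
        · simp only [Finset.smul_finset_singleton, smul_eq_mul, mul_one,
            Finset.mem_singleton] at hx
          exact hx ▸ (Finset.mem_sdiff.1 hc).1
        · exact hT.subset _ hc hx
      · intro hx
        by_cases hxV : x ∈ V
        · obtain ⟨⟨c, A⟩, hp, hxA⟩ := Finset.mem_biUnion.1 hxV
          exact ⟨c, Or.inr ⟨⟨A, hTX _ hp⟩, hp, hxA⟩⟩
        · exact ⟨x, Or.inl ⟨Finset.mem_sdiff.2 ⟨hx, hxV⟩, by simp⟩⟩
  have hsome : ∀ A : X, ((T₁ ∪ T₂).filter fun p => p.2 = some A).card = N A := by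
    intro A
    rw [← hN A]
    refine Finset.card_bij (fun p _ => (p.1, A.1)) ?_ ?_ ?_
    · rintro ⟨c, B⟩ hp
      simp only [Finset.mem_filter, Finset.mem_union] at hp ⊢
      obtain ⟨hp, rfl⟩ := hp
      simpa [hmem₁, hmem₂'] using hp
    · rintro ⟨c, B⟩ hp ⟨d, C⟩ hq hpq
      have hB : B = some A := (Finset.mem_filter.1 hp).2
      have hC : C = some A := (Finset.mem_filter.1 hq).2
      have hc : c = d := (Prod.mk.inj hpq).1
      rw [hB, hC, hc]
    · rintro ⟨c, B⟩ hp
      obtain ⟨hp, hB⟩ := Finset.mem_filter.1 hp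
      refine ⟨(c, some A), Finset.mem_filter.2 ⟨Finset.mem_union_left _ ((hmem₁ c A).2 ?_), rfl⟩,
        ?_⟩
      · exact hB ▸ hp
      · rw [← hB]
  refine ⟨T₁ ∪ T₂, htile, hsome, ?_⟩
  have h1 : F.card = ∑ L : Option X, ((T₁ ∪ T₂).filter fun p => p.2 = L).card *
      (tileOf X L).card := by
    simp_rw [← htile.card_covered]
    rw [← Finset.card_biUnion]
    · congr 1
      rw [← htile.union]
      ext x
      simp only [covered, Finset.mem_biUnion, Finset.mem_filter, Finset.mem_univ, true_and]
      exact ⟨fun ⟨p, hp, hx⟩ => ⟨p.2, p, ⟨hp, rfl⟩, hx⟩, fun ⟨_, p, ⟨hp, _⟩, hx⟩ => ⟨p, hp, hx⟩⟩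
    · intro L _ L' _ hne
      rw [Function.onFun, Finset.disjoint_left]
      intro x hx hx'
      obtain ⟨p, hp, hxp⟩ := Finset.mem_biUnion.1 hx
      obtain ⟨q, hq, hxq⟩ := Finset.mem_biUnion.1 hx'
      rw [Finset.mem_filter] at hp hq
      refine Finset.disjoint_left.1 (htile.disjoint hp.1 hq.1 ?_) hxp hxq
      rintro rfl
      exact hne (hp.2.symm.trans hq.2)
  rw [Fintype.sum_option] at h1
  simp_rw [hsome] at h1
  simp only [tileOf, Finset.card_singleton, mul_one] at h1
  rw [Finset.sum_coe_sort X (fun A => N A * A.card)] at h1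
  have h2 : (F.card : ℝ) = _ := congrArg Nat.cast h1
  push_cast at h2
  linarith

/-! ### The Bratteli diagram and its harmonic function. -/

/-- The edges of the Bratteli diagram `Z` between shapes have the multiplicities `K`. -/
structure TileData.HasMult (Z : TileData Γ) (K : ℕ → Finset Γ → Finset Γ → ℕ) : Prop where
  isTiling : ∀ n, ∀ B : Z.shapes (n + 1), IsTiling (Z.tile n) (Z.partition n B) B
  mult_some : ∀ n, ∀ A : Z.shapes n, ∀ B : Z.shapes (n + 1),
    Z.mult n (some A) (some B) = K n B A
  mult_none : ∀ n, ∀ B : Z.shapes (n + 1),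
    (Z.mult n none (some B) : ℝ) = B.1.card - ∑ A ∈ Z.shapes n, (K n B A : ℝ) * A.card

/-- The extension of a function on shapes to a function of total mass `1` on every level. -/
def TileData.weight (Z : TileData Γ) (m : ℕ → Finset Γ → ℝ) (n : ℕ) : Z.Vertex n → ℝ
  | some A => m n A.1
  | none => 1 - ∑ A ∈ Z.shapes n, m n A

theorem IsPrunedSystem.exists_tileData {S : Finset Γ} {X : ℕ → Finset (Finset Γ)}
    {K : ℕ → Finset Γ → Finset Γ → ℕ} {m : ℕ → Finset Γ → ℝ} (h : IsPrunedSystem S X K m) :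
    ∃ Z : TileData Γ, IsPrunedSystem S Z.shapes K m ∧ Z.HasMult K := by
  choose T hT hsome hnone using fun n (B : X (n + 1)) =>
    (h.realizes n B.1 B.2).exists_isTiling (h.eq_zero n B.1 B.2)
  refine ⟨⟨X, T⟩, h, fun n B => ?_, fun n A B => hsome n B A, hnone⟩
  rw [TileData.tile_eq_tileOf]
  exact hT n B

namespace IsPrunedSystem

variable {S : Finset Γ} {Z : TileData Γ} {K : ℕ → Finset Γ → Finset Γ → ℕ}
  {m : ℕ → Finset Γ → ℝ}

theorem isBratteliSystem (h : IsPrunedSystem S Z.shapes K m) (hZ : Z.HasMult K) :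
    IsBratteliSystem S Z where
  shape_nonempty n _ A hA := h.nonempty n A hA
  isoperimetric_le n _ A hA := h.isoperimetric_le n A hA
  isTiling n _ B := hZ.isTiling n B
  mult_single_le n _ B := by
    rw [hZ.mult_none n B]
    linarith [h.sum_ge n B.1 B.2]
  exists_edge n _ A := by
    cases A with
    | none => exact ⟨none, by simp [TileData.mult]⟩
    | some A =>
      obtain ⟨B, hB, hK⟩ := h.exists_pos n A.1 A.2
      exact ⟨some ⟨B, hB⟩, by rwa [hZ.mult_some n A ⟨B, hB⟩]⟩

/-- On shapes this is the harmonicity of `m`, as `E_{n+1}` contains no shape. The equation at `none`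
is then forced: singletons make up the complement of the packing in each shape, and the weights on
each level sum to `1`. -/
theorem isHarmonic (h : IsPrunedSystem S Z.shapes K m) (hZ : Z.HasMult K) :
    IsHarmonic Z (Z.weight m) where
  nonneg n _ A := by
    cases A with
    | none => exact sub_nonneg.2 (h.harmonic_sum_le n)
    | some A => exact h.harmonic_nonneg n A.1 A.2
  sum_eq_one n _ := by
    rw [Fintype.sum_option]
    simp only [TileData.weight]
    rw [Finset.sum_coe_sort (Z.shapes n) (fun A => m n A)]
    ring
  harmonic n _ A := by
    rw [Fintype.sum_option]
    cases A with
    | some A =>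
      simp_rw [hZ.mult_some n A]
      simp only [TileData.mult, reduceCtorEq, if_false, Nat.cast_zero, mul_zero, zero_div,
        zero_mul, zero_add, TileData.weight, TileData.size, TileData.tile]
      rw [h.harmonic n A.1 A.2, ← Finset.sum_coe_sort (Z.shapes (n + 1))]
      exact Finset.sum_congr rfl fun B _ => by rw [mul_comm (K n B A : ℝ)]
    | none =>
      simp_rw [hZ.mult_none n]
      simp only [TileData.mult, if_true, Nat.cast_one, mul_one, one_mul, div_one,
        TileData.weight, TileData.size, TileData.tile, Finset.card_singleton]
      have h1 : ∀ B : Z.shapes (n + 1), ((B.1.card : ℝ) -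
          ∑ A ∈ Z.shapes n, (K n B A : ℝ) * A.card) / B.1.card * m (n + 1) B = m (n + 1) B -
          ∑ A ∈ Z.shapes n, (K n B A : ℝ) * A.card / B.1.card * m (n + 1) B := by
        intro B
        have hB : (B.1.card : ℝ) ≠ 0 := by
          exact_mod_cast (h.nonempty (n + 1) B.1 B.2).card_pos.ne'
        rw [sub_div, div_self hB, sub_mul, one_mul, Finset.sum_div, Finset.sum_mul]
      rw [Finset.sum_congr rfl fun B _ => h1 B, Finset.sum_sub_distrib,
        Finset.sum_coe_sort (Z.shapes (n + 1)) (fun B => m (n + 1) B),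
        Finset.sum_coe_sort (Z.shapes (n + 1)) (fun B =>
          ∑ A ∈ Z.shapes n, (K n B A : ℝ) * A.card / B.card * m (n + 1) B), Finset.sum_comm,
        Finset.sum_congr rfl fun A hA => (h.harmonic n A hA).symm]
      ring

theorem isBratteliTilingSystem (h : IsPrunedSystem S Z.shapes K m) (hZ : Z.HasMult K) :
    IsBratteliTilingSystem S Z (Z.weight m) where
  isBratteliSystem := h.isBratteliSystem hZ
  isHarmonic := h.isHarmonic hZ
  tendsto_single := by
    refine squeeze_zero (fun n => sub_nonneg.2 (h.harmonic_sum_le n)) (fun n => ?_)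
      (tendsto_pow_atTop_nhds_zero_of_lt_one (r := (1 / 2 : ℝ)) (by norm_num) (by norm_num))
    change 1 - ∑ A ∈ Z.shapes n, m n A ≤ _
    linarith [h.harmonic_sum_ge n]

theorem exists_isTiling_close (h : IsPrunedSystem S Z.shapes K m) {ε : ℝ} (hε : 0 < ε) (n : ℕ) :
    ∃ δ : ℝ, 0 < δ ∧ ∀ F : Finset Γ, F.Nonempty → isoperimetric S F < δ →
      ∃ T : Finset (Γ × Z.Vertex n), IsTiling (Z.tile n) T F ∧ ∀ L : Z.Vertex n,
        |((covered (Z.tile n) T L).card : ℝ) / (F.card : ℝ) - Z.weight m n L| < ε := by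
  obtain ⟨δ, hδ, hF⟩ := h.exists_close n ε hε
  refine ⟨δ, hδ, fun F hFne hFi => ?_⟩
  obtain ⟨N, hN, hNX, hNm⟩ := hF F hFne hFi
  obtain ⟨T, hT, hsome, hnone⟩ := hN.exists_isTiling hNX
  have hfpos : (F.card : ℝ) ≠ 0 := by exact_mod_cast hFne.card_pos.ne'
  rw [TileData.tile_eq_tileOf]
  refine ⟨T, hT, fun L => ?_⟩
  refine lt_of_le_of_lt ?_ hNm
  rw [hT.card_covered L, Nat.cast_mul]
  cases L with
  | some A =>
    rw [hsome A]
    exact Finset.single_le_sum (f := fun A => |(N A : ℝ) * A.card / F.card - m n A|)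
      (fun _ _ => abs_nonneg _) A.2
  | none =>
    rw [hnone]
    -- The error at `E_n` is minus the sum of the errors at the shapes, so the ℓ¹ bound on shapes
    -- covers it as well.
    have h1 : (F.card - ∑ A ∈ Z.shapes n, (N A : ℝ) * A.card) * ((tileOf (Z.shapes n) none).card)
        / F.card - Z.weight m n none =
        -∑ A ∈ Z.shapes n, ((N A : ℝ) * A.card / F.card - m n A) := by
      simp only [tileOf, TileData.weight, Finset.card_singleton, Nat.cast_one, mul_one]
      rw [sub_div, div_self hfpos, Finset.sum_sub_distrib, Finset.sum_div]
      ring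
    rw [h1, abs_neg]
    exact Finset.abs_sum_le_sum_abs _ _

end IsPrunedSystem

end Bratteli

theorem proposition3p1 {Γ : Type*} [Group Γ] [DecidableEq Γ] (S : Finset Γ)
    (hsymm : ∀ s ∈ S, s⁻¹ ∈ S) (hgen : Subgroup.closure (S : Set Γ) = ⊤)
    (hamen : Bratteli.IsAmenable S) :
    ∃ (Z : Bratteli.TileData Γ) (m : ∀ n, Z.Vertex n → ℝ),
      Bratteli.IsBratteliTilingSystem S Z m ∧
      ∀ ε : ℝ, 0 < ε → ∀ n : ℕ, 1 ≤ n → ∃ δ : ℝ, 0 < δ ∧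
        ∀ F : Finset Γ, F.Nonempty → Bratteli.isoperimetric S F < δ →
          ∃ T : Finset (Γ × Z.Vertex n), Bratteli.IsTiling (Z.tile n) T F ∧
            ∀ L : Z.Vertex n,
              |((Bratteli.covered (Z.tile n) T L).card : ℝ) / (F.card : ℝ) - m n L| < ε := by
  obtain ⟨Y, p, K, h⟩ := Bratteli.exists_isShapeSystem hsymm hgen hamen
  obtain ⟨X, m, hX⟩ := h.exists_isPrunedSystem
  obtain ⟨Z, hX, hZ⟩ := hX.exists_tileData
  exact ⟨Z, Z.weight m, hX.isBratteliTilingSystem hZ,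
    fun ε hε n _ => hX.exists_isTiling_close hε n⟩
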